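/- Let $n\ge 0$ and $K\ge 1$ be integers, let $0<\tau_1<\dots<\tau_K<\infty$, let $J=\begin{bmatrix}0&I_n\\-I_n&0\end{bmatrix}$, and let $H_0,H_{\pm1},\dots,H_{\pm K}\in\mathbb{R}^{2n\times 2n}$ satisfy $(JH_0)^{\top}=JH_0$ and $(JH_{-k})^{\top}=JH_k$ for $k=1,\dots,K$. On $X=C([-\tau_K,\tau_K],\mathbb{C}^{2n})$ let $\mathcal{H}\varphi=\varphi'$ be the operator whose domain $D(\mathcal{H})$ consists of the continuously differentiable $\varphi\in X$ with $$\varphi'(0)=H_0\varphi(0)+\sum_{k=1}^{K}\bigl(H_{-k}\varphi(-\tau_k)+H_k\varphi(\tau_k)\bigr).$$ For $\sigma\in\mathbb{C}$ let $\mathcal{R}_\sigma=(\mathcal{H}-\sigma I)(\mathcal{H}+\sigma I)$, with domain $\{\varphi\in D(\mathcal{H}):(\mathcal{H}+\sigma I)\varphi\in D(\mathcal{H})\}$. An eigenvalue is called simple if its algebraic multiplicity, i.e. the dimension of $\bigcup_{j}\ker(\mathcal{H}-\lambda I)^j$, is one. Suppose that $\sigma$ is not an eigenvalue of $\mathcal{H}$.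 Then $\mathcal{R}_\sigma$ maps its domain bijectively onto $X$, and its inverse $\mathcal{R}_\sigma^{-1}:X\to X$ has the following properties. 1. A number $\lambda\in\mathbb{C}$ is an eigenvalue of $\mathcal{H}$ if and only if $\lambda^2\neq\sigma^2$ and $\mu=\frac{1}{\lambda^2-\sigma^2}$ is an eigenvalue of $\mathcal{R}_\sigma^{-1}$. Moreover, if $\mu$ is an eigenvalue of $\mathcal{R}_\sigma^{-1}$, then $\mu\neq0$ and both square roots $\pm\sqrt{\frac1\mu+\sigma^2}$ are eigenvalues of $\mathcal{H}$. 2. If $\lambda\neq0$ and $-\lambda$ are simple eigenvalues of $\mathcal{H}$ with eigenfunctions $\varphi_+$ and $\varphi_-$, respectively, then the eigenspace of $\mathcal{R}_\sigma^{-1}$ for the eigenvalue $\mu=\frac{1}{\lambda^2-\sigma^2}$ is spanned by $\{\varphi_+,\varphi_-\}$. 3. Every eigenvalue of $\mathcal{R}_\sigma^{-1}$ has finite and even multiplicity; this holds both for the algebraic multiplicity $\dim\bigcup_j\ker(\mathcal{R}_\sigma^{-1}-\mu I)^j$ and for the geometric multiplicity $\dim\ker(\mathcal{R}_\sigma^{-1}-\mu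 I)$. -/

import Mathlib

open scoped Matrix

noncomputable section

namespace HamiltonianDelay

/-! ### Unbounded operators `T : D(T) ⊆ E → E` -/

section Operators

variable {E : Type*} [AddCommGroup E] [Module ℂ E]

/-- The operator `T + c I`, with domain `D(T)`. -/
def shift (T : E →ₗ.[ℂ] E) (c : ℂ) : E →ₗ.[ℂ] E :=
  (c • (LinearMap.id : E →ₗ[ℂ] E)) +ᵥ T

/-- The product `A B`, with its natural domain `{x ∈ D(B) | B x ∈ D(A)}`. -/
def product (A B : E →ₗ.[ℂ] E) : E →ₗ.[ℂ] E where
  domain := (A.domain.comap B.toFun).map B.domain.subtype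
  toFun :=
    A.toFun ∘ₗ
      (B.toFun.restrict (p := A.domain.comap B.toFun) (q := A.domain) (fun _ h => h)) ∘ₗ
      (Submodule.equivSubtypeMap B.domain (A.domain.comap B.toFun)).symm.toLinearMap

theorem mem_product_domain (A B : E →ₗ.[ℂ] E) (x : E) :
    x ∈ (product A B).domain ↔ ∃ h : x ∈ B.domain, B ⟨x, h⟩ ∈ A.domain := by
  constructor
  · rintro ⟨y, hy, rfl⟩
    exact ⟨y.2, hy⟩
  · rintro ⟨h, hx⟩
    exact ⟨⟨x, h⟩, hx, rfl⟩

theorem product_apply (A B : E →ₗ.[ℂ] E) (x : E) (h : x ∈ B.domain)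
    (hx : B ⟨x, h⟩ ∈ A.domain) :
    product A B ⟨x, (mem_product_domain A B x).2 ⟨h, hx⟩⟩ = A ⟨B ⟨x, h⟩, hx⟩ := by
  have key : (Submodule.equivSubtypeMap B.domain (A.domain.comap B.toFun)).symm
      ⟨x, (mem_product_domain A B x).2 ⟨h, hx⟩⟩ = ⟨⟨x, h⟩, hx⟩ := by
    rw [LinearEquiv.symm_apply_eq]
    rfl
  change A.toFun ((B.toFun.restrict (p := A.domain.comap B.toFun) (q := A.domain)
    (fun _ h => h)) ((Submodule.equivSubtypeMap B.domain (A.domain.comap B.toFun)).symm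
      ⟨x, (mem_product_domain A B x).2 ⟨h, hx⟩⟩)) = _
  rw [key]
  rfl

/-- `x` is an eigenvector (eigenfunction) of `T` associated with `z`. -/
def IsEigenvector (T : E →ₗ.[ℂ] E) (z : ℂ) (x : E) : Prop :=
  x ≠ 0 ∧ ∃ h : x ∈ T.domain, T ⟨x, h⟩ = z • x

/-- `z` is an eigenvalue of `T`. -/
def IsEigenvalue (T : E →ₗ.[ℂ] E) (z : ℂ) : Prop :=
  ∃ x : E, IsEigenvector T z x

/-- The kernel of `(T - z I)ʲ`, with the natural domain of the power. -/
def genEigenspace (T : E →ₗ.[ℂ] E) (z : ℂ) : ℕ → Submodule ℂ E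
  | 0 => ⊥
  | j + 1 => ((genEigenspace T z j).comap (shift T (-z)).toFun).map T.domain.subtype

/-- The algebraic eigenspace `⋃ⱼ ker (T - z I)ʲ`. -/
def maxGenEigenspace (T : E →ₗ.[ℂ] E) (z : ℂ) : Submodule ℂ E :=
  ⨆ j : ℕ, genEigenspace T z j

/-- `z` is a simple eigenvalue of `T`: its algebraic multiplicity is one. -/
def IsSimpleEigenvalue (T : E →ₗ.[ℂ] E) (z : ℂ) : Prop :=
  IsEigenvalue T z ∧ Module.finrank ℂ (maxGenEigenspace T z) = 1

open Classical in
/-- The inverse `T⁻¹ : E → D(T) ⊆ E` of an operator that maps `D(T)` bijectively onto `E`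
(and `0` if `T` is not such an operator). -/
def inverse (T : E →ₗ.[ℂ] E) : E →ₗ[ℂ] E :=
  if h : Function.Bijective T.toFun then
    T.domain.subtype ∘ₗ (LinearEquiv.ofBijective T.toFun h).symm.toLinearMap
  else 0

end Operators

/-! ### The delay eigenvalue problem and its operator -/

/-- The matrix `J = [0, I; -I, 0]`. -/
def J (n : ℕ) : Matrix (Fin n ⊕ Fin n) (Fin n ⊕ Fin n) ℝ :=
  Matrix.fromBlocks 0 1 (-1) 0

/-- The matrices and delays of a Hamiltonian delay eigenvalue problem.  There are `K + 1 ≥ 1`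
delays `0 < τ 0 < ⋯ < τ K`; the matrix `Hneg k` belongs to `-τ k` and `Hpos k` to `τ k`. -/
structure DelaySystem (n K : ℕ) where
  H0 : Matrix (Fin n ⊕ Fin n) (Fin n ⊕ Fin n) ℝ
  Hpos : Fin (K + 1) → Matrix (Fin n ⊕ Fin n) (Fin n ⊕ Fin n) ℝ
  Hneg : Fin (K + 1) → Matrix (Fin n ⊕ Fin n) (Fin n ⊕ Fin n) ℝ
  τ : Fin (K + 1) → ℝ
  τ_pos : ∀ k, 0 < τ k
  τ_strictMono : StrictMono τ
  hamiltonian_zero : (J n * H0)ᵀ = J n * H0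
  hamiltonian_delay : ∀ k, (J n * Hneg k)ᵀ = J n * Hpos k

namespace DelaySystem

variable {n K : ℕ} (S : DelaySystem n K)

/-- The largest delay. -/
def τmax : ℝ := S.τ (Fin.last K)

theorem τmax_pos : 0 < S.τmax := S.τ_pos _

theorem neg_le_self : -S.τmax ≤ S.τmax := by linarith [S.τmax_pos]

theorem τ_le_τmax (k : Fin (K + 1)) : S.τ k ≤ S.τmax :=
  S.τ_strictMono.monotone (Fin.le_last k)

/-- The interval `[-τ_max, τ_max]`. -/
abbrev Interval : Set ℝ := Set.Icc (-S.τmax) S.τmax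

/-- The space of continuous functions from `[-τ_max, τ_max]` to `ℂ²ⁿ`. -/
abbrev X : Type := C(S.Interval, Fin n ⊕ Fin n → ℂ)

/-- The point `0` of the interval. -/
def pt0 : S.Interval := ⟨0, by linarith [S.τmax_pos], S.τmax_pos.le⟩

/-- The point `τ k` of the interval. -/
def ptPos (k : Fin (K + 1)) : S.Interval :=
  ⟨S.τ k, by linarith [S.τmax_pos, S.τ_pos k], S.τ_le_τmax k⟩

/-- The point `-τ k` of the interval. -/
def ptNeg (k : Fin (K + 1)) : S.Interval :=
  ⟨-S.τ k, by linarith [S.τ_le_τmax k], by linarith [S.τmax_pos, S.τ_pos k]⟩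

/-- `φ` is differentiable on the interval (one-sidedly at the end points) and `φ' = ψ`; since
`ψ` is an element of `X`, `φ` is then continuously differentiable. -/
def IsDeriv (φ ψ : S.X) : Prop :=
  ∀ θ : S.Interval,
    HasDerivWithinAt (Set.IccExtend S.neg_le_self φ) (ψ θ) S.Interval (θ : ℝ)

/-- `H₀ φ(0) + ∑ₖ (H₋ₖ φ(-τₖ) + Hₖ φ(τₖ))`. -/
def boundary (φ : S.X) : Fin n ⊕ Fin n → ℂ :=
  (S.H0.map Complex.ofReal) *ᵥ φ S.pt0 +
    ∑ k, ((S.Hneg k).map Complex.ofReal *ᵥ φ (S.ptNeg k) +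
      (S.Hpos k).map Complex.ofReal *ᵥ φ (S.ptPos k))

variable {S}

theorem IsDeriv.unique {φ ψ ψ' : S.X} (h : S.IsDeriv φ ψ) (h' : S.IsDeriv φ ψ') : ψ = ψ' := by
  ext1 θ
  have hlt : -S.τmax < S.τmax := by linarith [S.τmax_pos]
  exact (uniqueDiffOn_Icc hlt _ θ.2).eq_deriv _ (h θ) (h' θ)

theorem IsDeriv.add {φ φ' ψ ψ' : S.X} (h : S.IsDeriv φ ψ) (h' : S.IsDeriv φ' ψ') :
    S.IsDeriv (φ + φ') (ψ + ψ') := fun θ => (h θ).add (h' θ)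

theorem IsDeriv.smul {φ ψ : S.X} (c : ℂ) (h : S.IsDeriv φ ψ) :
    S.IsDeriv (c • φ) (c • ψ) := fun θ => (h θ).const_smul c

theorem isDeriv_zero : S.IsDeriv 0 0 := fun _ => hasDerivWithinAt_const _ _ _

theorem boundary_add (φ ψ : S.X) : S.boundary (φ + ψ) = S.boundary φ + S.boundary ψ := by
  simp only [boundary, ContinuousMap.add_apply, Matrix.mulVec_add, Finset.sum_add_distrib]
  abel

theorem boundary_smul (c : ℂ) (φ : S.X) : S.boundary (c • φ) = c • S.boundary φ := by
  simp only [boundary, ContinuousMap.smul_apply, Matrix.mulVec_smul, smul_add, Finset.smul_sum]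

variable (S)

/-- `D(𝓗)`: the continuously differentiable `φ` with
`φ'(0) = H₀ φ(0) + ∑ₖ (H₋ₖ φ(-τₖ) + Hₖ φ(τₖ))`. -/
def domainH : Submodule ℂ S.X where
  carrier := {φ | ∃ ψ : S.X, S.IsDeriv φ ψ ∧ ψ S.pt0 = S.boundary φ}
  add_mem' := by
    rintro φ φ' ⟨ψ, h, hb⟩ ⟨ψ', h', hb'⟩
    exact ⟨ψ + ψ', h.add h', by rw [boundary_add, ContinuousMap.add_apply, hb, hb']⟩
  zero_mem' := ⟨0, isDeriv_zero, by simp [boundary]⟩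
  smul_mem' := by
    rintro c φ ⟨ψ, h, hb⟩
    exact ⟨c • ψ, h.smul c, by rw [boundary_smul, ContinuousMap.smul_apply, hb]⟩

/-- The derivative of an element of `D(𝓗)`. -/
def derivH (φ : S.domainH) : S.X := φ.2.choose

theorem derivH_spec (φ : S.domainH) : S.IsDeriv (φ : S.X) (S.derivH φ) := φ.2.choose_spec.1

/-- The operator `𝓗 φ = φ'` with domain `D(𝓗)`. -/
def opH : S.X →ₗ.[ℂ] S.X where
  domain := S.domainH
  toFun :=
    { toFun := S.derivH
      map_add' := fun φ φ' =>
        (S.derivH_spec (φ + φ')).unique ((S.derivH_spec φ).add (S.derivH_spec φ'))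
      map_smul' := fun c φ => (S.derivH_spec (c • φ)).unique ((S.derivH_spec φ).smul c) }

/-- The operator `𝓡_σ = (𝓗 - σ I) (𝓗 + σ I)`. -/
def opR (σ : ℂ) : S.X →ₗ.[ℂ] S.X := product (shift S.opH (-σ)) (shift S.opH σ)

/-- The operator `𝓡_σ⁻¹` on `X`. -/
def opRinv (σ : ℂ) : S.X →ₗ[ℂ] S.X := inverse (S.opR σ)

end DelaySystem

end HamiltonianDelay

end

/-! Write `M(z)` for the characteristic matrix `charMat`. Eigenfunctions of `𝓗` are `e^{zθ} v` with
`M(z) v = 0`, and the Hamiltonian structure gives `(J M(z))ᵀ = J M(-z)`, so the spectrum is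
symmetric under `z ↦ -z`. Hence `𝓗 - σ` and `𝓗 + σ` are both bijective, by variation of constants
and a correction of the boundary condition, and so is `𝓡_σ`. The eigenfunctions of `𝓡_σ⁻¹` for
`1/(λ² - σ²)` are the nonzero solutions of `𝓗²φ = λ²φ`; splitting them with `𝓗 ± λ` gives properties
1 and 2.

For the parity, put `c = 1/μ + σ²` and `A = ℂ[x]/((x² - c)ʲ)`, with `t` the coefficient of
`x^{2j-1}`. A vector `a` over `A` gives the function `θ ↦ t(e^{θx} a)`. Differentiation becomes
multiplication by `x`, and the boundary condition for all multiples of `a` becomes `M(x) a = 0`.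
This identifies `ker (𝓡_σ⁻¹ - μ)ʲ` with `ker M(x)`, which is finite-dimensional. Let `bar` be the
involution `x ↦ -x` of `A`. Since `2j - 1` is odd, `t ∘ bar = -t`, so the symmetry of `J M` makes
`t(∑ᵢ bar(uᵢ) (J M(x) v)ᵢ)` a skew form over `ℂ`. Its radical is `ker M(x)`, as `t` is nondegenerate
and `J` invertible. The whole space has even dimension and a skew form has even rank, so the kernel
has even dimension (`even_finrank_kerCharMat`, `even_finrank_ker_pow`). The case `c = 0` needs no
separate treatment.

The power `j = 1` gives the geometric multiplicity. For the algebraic one, `𝓡_σ⁻¹` is compact, so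
the kernels of the powers stabilize at some finite `j`. -/

noncomputable section

namespace HamiltonianDelay

/-! ### Parity of the radical of a skew form -/

section LinearAlgebra

/-- A nondegenerate skew-symmetric bilinear form lives on an even-dimensional space. -/
theorem even_finrank_of_skew_of_nondegenerate {V : Type*} [AddCommGroup V] [Module ℂ V]
    [FiniteDimensional ℂ V] (B : V →ₗ[ℂ] V →ₗ[ℂ] ℂ) (hB : ∀ u v, B u v = -B v u)
    (hnd : ∀ u, (∀ v, B u v = 0) → u = 0) : Even (Module.finrank ℂ V) := by
  let b := Module.finBasis ℂ V
  let M : Matrix (Fin (Module.finrank ℂ V)) (Fin (Module.finrank ℂ V)) ℂ :=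
    Matrix.of fun i j => B (b i) (b j)
  have hMT : Mᵀ = -M := by
    ext i j
    exact hB (b j) (b i)
  have hdet : M.det ≠ 0 := by
    intro h0
    obtain ⟨w, hw, hwM⟩ := Matrix.exists_vecMul_eq_zero_iff.2 h0
    apply hw
    have hu : ∑ i, w i • b i = 0 := by
      refine hnd _ fun v => ?_
      have : B (∑ i, w i • b i) = 0 := by
        refine b.ext fun j => ?_
        have := congrFun hwM j
        simpa [Matrix.vecMul, dotProduct, M] using this
      rw [this]; rfl
    funext i
    exact Fintype.linearIndependent_iff.1 b.linearIndependent w hu i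
  have h2 : M.det = (-1) ^ Module.finrank ℂ V * M.det := by
    conv_lhs => rw [← Matrix.det_transpose, hMT, Matrix.det_neg, Fintype.card_fin]
  by_contra hodd
  rw [Nat.not_even_iff_odd] at hodd
  rw [hodd.neg_one_pow] at h2
  exact hdet (by linear_combination h2 / 2)

/-- A skew-symmetric bilinear form has even rank. -/
theorem even_finrank_ker_of_skew {V : Type*} [AddCommGroup V] [Module ℂ V]
    [FiniteDimensional ℂ V] (B : V →ₗ[ℂ] V →ₗ[ℂ] ℂ) (hB : ∀ u v, B u v = -B v u)
    (hV : Even (Module.finrank ℂ V)) : Even (Module.finrank ℂ (LinearMap.ker B)) := by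
  obtain ⟨W, hW⟩ := Submodule.exists_isCompl (LinearMap.ker B)
  -- The form is nondegenerate on any complement of its kernel.
  have hWe : Even (Module.finrank ℂ W) := by
    refine even_finrank_of_skew_of_nondegenerate (B.domRestrict₁₂ W W)
      (fun u v => hB u v) fun u hu => ?_
    have hk : (u : V) ∈ LinearMap.ker B := by
      rw [LinearMap.mem_ker]
      ext v
      have hv : v ∈ LinearMap.ker B ⊔ W := by rw [hW.sup_eq_top]; trivial
      obtain ⟨k, hk, w, hw, rfl⟩ := Submodule.mem_sup.1 hv
      have h1 : B u k = 0 := by rw [hB, LinearMap.mem_ker.1 hk]; simp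
      have h2 : B u w = 0 := hu ⟨w, hw⟩
      simp [h1, h2]
    have : (u : V) ∈ LinearMap.ker B ⊓ W := ⟨hk, u.2⟩
    rw [hW.inf_eq_bot] at this
    exact Subtype.ext this
  have := Submodule.finrank_add_eq_of_isCompl hW
  rw [← this, Nat.even_add] at hV
  exact hV.2 hWe

end LinearAlgebra

/-! ### Riesz theory: stabilization of kernels for a compact operator -/

section CompactOperator

variable {E : Type*} [NormedAddCommGroup E] [NormedSpace ℂ E]

/-- The kernels of the powers of `T - μ` stabilize if `T` is compact and `μ ≠ 0`. -/
theorem exists_ker_pow_eq_of_isCompactOperator (T : E →ₗ[ℂ] E) (hT : IsCompactOperator T)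
    {μ : ℂ} (hμ : μ ≠ 0) :
    ∃ k : ℕ, LinearMap.ker ((T - μ • (1 : Module.End ℂ E)) ^ (k + 1)) ≤
      LinearMap.ker ((T - μ • (1 : Module.End ℂ E)) ^ k) := by
  by_contra hne
  push Not at hne
  set S : Module.End ℂ E := T - μ • (1 : Module.End ℂ E) with hS
  have hTc : Continuous T := hT.continuous
  have hSc : Continuous S := hTc.sub (continuous_id.const_smul μ)
  have hpow : ∀ k : ℕ, Continuous ((S ^ k : Module.End ℂ E) : E → E) := fun k => by
    rw [Module.End.coe_pow]
    exact hSc.iterate k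
  let V (k : ℕ) : Submodule ℂ E := LinearMap.ker (S ^ k)
  have hV_closed (k : ℕ) : IsClosed (V k : Set E) := by
    have : (V k : Set E) = (S ^ k : Module.End ℂ E) ⁻¹' {0} := by ext; simp [V]
    rw [this]
    exact isClosed_singleton.preimage (hpow k)
  have hV_mono : Monotone V := by
    refine monotone_nat_of_le_succ fun k x hx => ?_
    simp only [V, LinearMap.mem_ker] at hx ⊢
    rw [pow_succ', Module.End.mul_apply, hx, map_zero]
  have hSV {k : ℕ} {x : E} (hx : x ∈ V (k + 1)) : S x ∈ V k := by
    simp only [V, LinearMap.mem_ker] at hx ⊢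
    rwa [pow_succ, Module.End.mul_apply] at hx
  obtain ⟨c, hc⟩ := NormedField.exists_one_lt_norm ℂ
  -- Riesz's lemma: bounded vectors of `V (k + 1)` at distance at least `1` from `V k`. Their images
  -- under `T` stay `‖μ‖` apart, which contradicts compactness.
  have hex (k : ℕ) : ∃ x ∈ V (k + 1), ‖x‖ ≤ ‖c‖ + 1 ∧ ∀ y ∈ V k, 1 ≤ ‖x - y‖ := by
    have h₁ : IsClosed ((V k).comap (V (k + 1)).subtype : Set (V (k + 1))) := by
      simpa using! (hV_closed k).preimage_val
    have h₂ : ∃ x : V (k + 1), x ∉ (V k).comap (V (k + 1)).subtype := by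
      obtain ⟨x, hx, hx'⟩ := SetLike.not_le_iff_exists.1 (hne k)
      exact ⟨⟨x, hx⟩, hx'⟩
    obtain ⟨⟨x, hx⟩, hxn, hxy⟩ := riesz_lemma_of_norm_lt hc (lt_add_one ‖c‖) h₁ h₂
    exact ⟨x, hx, hxn, fun y hy => hxy ⟨y, hV_mono k.le_succ hy⟩ hy⟩
  choose f hfV hfn hf_far using hex
  have hlt : ∀ m n, m < n → ‖μ‖ ≤ ‖T (f n) - T (f m)‖ := by
    intro m n hmn
    let u : E := μ⁻¹ • (S (f m) + μ • f m - S (f n))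
    have hu : μ • (f n - u) = T (f n) - T (f m) := by
      rw [smul_sub, smul_inv_smul₀ hμ]
      simp only [hS, LinearMap.sub_apply, LinearMap.smul_apply, Module.End.one_apply]
      abel
    have huV : u ∈ V n := by
      refine Submodule.smul_mem _ _ (Submodule.sub_mem _ (Submodule.add_mem _ ?_ ?_) ?_)
      · exact hV_mono hmn.le (hSV (hfV m))
      · exact Submodule.smul_mem _ _ (hV_mono hmn (hfV m))
      · exact hSV (hfV n)
    rw [← hu, norm_smul]
    exact le_mul_of_one_le_right (norm_nonneg _) (hf_far n u huV)
  obtain ⟨K, hK, hK'⟩ := hT.image_closedBall_subset_compact (‖c‖ + 1)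
  obtain ⟨y, -, ψ, hψ, hψy⟩ := hK.tendsto_subseq (fun n ↦ hK' ⟨f n, by simp [hfn], rfl⟩)
  replace hψy := hψy.cauchySeq
  rw [Metric.cauchySeq_iff'] at hψy
  obtain ⟨N, hN⟩ := hψy ‖μ‖ (norm_pos_iff.2 hμ)
  have : ‖T (f (ψ (N + 1))) - T (f (ψ N))‖ < ‖μ‖ := by
    simpa [dist_eq_norm_sub] using hN (N + 1)
  exact this.not_ge (hlt _ _ (hψ N.lt_succ_self))

/-- The generalized eigenspaces of a compact operator are attained at a finite level. -/
theorem exists_maxGenEigenspace_eq_of_isCompactOperator (T : E →ₗ[ℂ] E)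
    (hT : IsCompactOperator T) {μ : ℂ} (hμ : μ ≠ 0) :
    ∃ k : ℕ, Module.End.maxGenEigenspace T μ =
      LinearMap.ker ((T - μ • (1 : Module.End ℂ E)) ^ (k + 1)) := by
  obtain ⟨k, hk⟩ := exists_ker_pow_eq_of_isCompactOperator T hT hμ
  -- The exponent `k + 1` is used because the parity argument needs a nonzero power.
  refine ⟨k, ?_⟩
  set S : Module.End ℂ E := T - μ • (1 : Module.End ℂ E) with hS
  have key : ∀ m x, (S ^ (k + m)) x = 0 → (S ^ k) x = 0 := by
    intro m
    induction m with
    | zero => exact fun x hx => hx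
    | succ m ih =>
      intro x hx
      refine ih x ?_
      have h1 : (S ^ (k + 1)) ((S ^ m) x) = 0 := by
        rw [← Module.End.mul_apply, ← pow_add]
        convert hx using 3
        omega
      have h2 := hk h1
      rwa [LinearMap.mem_ker, ← Module.End.mul_apply, ← pow_add] at h2
  ext x
  rw [Module.End.mem_maxGenEigenspace, LinearMap.mem_ker]
  constructor
  · rintro ⟨m, hm⟩
    have : (S ^ (k + m)) x = 0 := by
      rw [pow_add, Module.End.mul_apply, hm, map_zero]
    rw [pow_succ', Module.End.mul_apply, key m x this, map_zero]
  · exact fun h => ⟨k + 1, h⟩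

end CompactOperator

/-! ### The product `(T - σ)(T + σ)` as `T² - σ²` -/

section Operators

variable {E : Type*} [AddCommGroup E] [Module ℂ E] (T : E →ₗ.[ℂ] E)

theorem shift_apply (c : ℂ) {x : E} (h : x ∈ (shift T c).domain) (h' : x ∈ T.domain) :
    shift T c ⟨x, h⟩ = c • x + T ⟨x, h'⟩ := rfl

/-- For `x` in `D(T)`, `σx + Tx` lies in `D(T)` exactly when `Tx` does, so the domain is that of
`T²`; the cross terms in `σ` cancel. -/
theorem product_shift_eq_iff (σ : ℂ) (x f : E) :
    (∃ h : x ∈ (product (shift T (-σ)) (shift T σ)).domain,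
      product (shift T (-σ)) (shift T σ) ⟨x, h⟩ = f) ↔
      ∃ y z : E, (∃ h : x ∈ T.domain, T ⟨x, h⟩ = y) ∧ (∃ h : y ∈ T.domain, T ⟨y, h⟩ = z) ∧
        z - σ ^ 2 • x = f := by
  constructor
  · rintro ⟨h, e⟩
    obtain ⟨h1, h2⟩ := (mem_product_domain _ _ _).1 h
    have e' := product_apply _ _ _ h1 h2
    have h1' : x ∈ T.domain := h1
    have h2' : σ • x + T ⟨x, h1'⟩ ∈ T.domain := h2
    have h3 : T ⟨x, h1'⟩ ∈ T.domain := by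
      simpa using T.domain.sub_mem h2' (T.domain.smul_mem σ h1')
    refine ⟨_, _, ⟨h1', rfl⟩, ⟨h3, rfl⟩, ?_⟩
    have e3 : T ⟨σ • x + T ⟨x, h1'⟩, h2'⟩ = σ • T ⟨x, h1'⟩ + T ⟨T ⟨x, h1'⟩, h3⟩ := by
      rw [← T.map_smul, ← T.map_add]; rfl
    have e4 : shift T (-σ) ⟨shift T σ ⟨x, h1⟩, h2⟩ =
        -σ • (σ • x + T ⟨x, h1'⟩) + T ⟨σ • x + T ⟨x, h1'⟩, h2'⟩ := rfl
    rw [← e]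
    refine Eq.trans ?_ e'.symm
    rw [e4, e3]
    module
  · rintro ⟨y, z, ⟨h1, rfl⟩, ⟨h2, rfl⟩, rfl⟩
    have h3 : σ • x + T ⟨x, h1⟩ ∈ T.domain := T.domain.add_mem (T.domain.smul_mem σ h1) h2
    have d1 : x ∈ (shift T σ).domain := h1
    have d2 : shift T σ ⟨x, d1⟩ ∈ (shift T (-σ)).domain := h3
    refine ⟨(mem_product_domain _ _ _).2 ⟨d1, d2⟩, (product_apply _ _ _ d1 d2).trans ?_⟩
    have e3 : T ⟨σ • x + T ⟨x, h1⟩, h3⟩ = σ • T ⟨x, h1⟩ + T ⟨T ⟨x, h1⟩, h2⟩ := by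
      rw [← T.map_smul, ← T.map_add]; rfl
    have e4 : shift T (-σ) ⟨shift T σ ⟨x, d1⟩, d2⟩ =
        -σ • (σ • x + T ⟨x, h1⟩) + T ⟨σ • x + T ⟨x, h1⟩, h3⟩ := rfl
    rw [e4, e3]
    module

end Operators

/-! ### Closedness of `𝓗` and compactness of Lipschitz balls -/

namespace DelaySystem

variable {n K : ℕ} {S : DelaySystem n K}

theorem IsDeriv.norm_sub_le {φ ψ : S.X} (h : S.IsDeriv φ ψ) {C : ℝ} (hC : ∀ θ, ‖ψ θ‖ ≤ C)
    (θ θ' : S.Interval) : ‖φ θ' - φ θ‖ ≤ C * ‖(θ' : ℝ) - θ‖ := by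
  have := (convex_Icc (-S.τmax) S.τmax).norm_image_sub_le_of_norm_hasDerivWithin_le
    (f := Set.IccExtend S.neg_le_self φ) (f' := Set.IccExtend S.neg_le_self ψ) (C := C)
    (fun x hx => by rw [Set.IccExtend_of_mem _ _ hx]; exact h ⟨x, hx⟩)
    (fun x _ => hC _) θ.2 θ'.2
  simpa only [Set.IccExtend_val] using this

theorem IsDeriv.eq_const {φ : S.X} (h : S.IsDeriv φ 0) (θ : S.Interval) : φ θ = φ S.pt0 := by
  have := h.norm_sub_le (C := 0) (by simp) S.pt0 θ
  rw [zero_mul, norm_le_zero_iff, sub_eq_zero] at this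
  exact this

/-- A function on the line that is differentiable with continuous derivative gives a pair of
elements of `X` related by differentiation. -/
theorem isDeriv_of_hasDerivAt {φ ψ : S.X} {f : ℝ → Fin n ⊕ Fin n → ℂ}
    (hf : ∀ θ : S.Interval, φ θ = f θ) (hd : ∀ θ : S.Interval, HasDerivAt f (ψ θ) θ) :
    S.IsDeriv φ ψ := by
  intro θ
  refine (hd θ).hasDerivWithinAt.congr (fun x hx => ?_) ?_
  · rw [Set.IccExtend_of_mem _ _ hx]; exact hf ⟨x, hx⟩
  · rw [Set.IccExtend_val]; exact hf θ

theorem continuous_extend (ψ : S.X) : Continuous (Set.IccExtend S.neg_le_self ψ) :=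
  ψ.continuous.Icc_extend'

/-- The primitive of `ψ` that vanishes at `0`. -/
def prim (ψ : S.X) : S.X where
  toFun θ := ∫ s in (0 : ℝ)..θ, Set.IccExtend S.neg_le_self ψ s
  continuous_toFun := (intervalIntegral.continuous_primitive
    (fun _ _ => (continuous_extend ψ).intervalIntegrable _ _) 0).comp continuous_subtype_val

theorem isDeriv_prim (ψ : S.X) : S.IsDeriv (prim ψ) ψ := by
  refine isDeriv_of_hasDerivAt
    (f := fun x => ∫ s in (0 : ℝ)..x, Set.IccExtend S.neg_le_self ψ s) (fun _ => rfl) fun θ => ?_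
  have := (continuous_extend ψ).integral_hasStrictDerivAt 0 (θ : ℝ)
  rw [Set.IccExtend_val] at this
  exact this.hasDerivAt

theorem prim_zero (ψ : S.X) : prim ψ S.pt0 = 0 := intervalIntegral.integral_same

theorem isDeriv_const (v : Fin n ⊕ Fin n → ℂ) : S.IsDeriv (ContinuousMap.const _ v) 0 :=
  fun _ => hasDerivWithinAt_const _ _ _

theorem IsDeriv.sub {φ φ' ψ ψ' : S.X} (h : S.IsDeriv φ ψ) (h' : S.IsDeriv φ' ψ') :
    S.IsDeriv (φ - φ') (ψ - ψ') := fun θ => (h θ).sub (h' θ)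

/-- The integral form consists of pointwise continuous equations in `φ` and `ψ`, from which
closedness of differentiation follows. -/
theorem isDeriv_iff {φ ψ : S.X} :
    S.IsDeriv φ ψ ↔ ∀ θ, φ θ = φ S.pt0 + prim ψ θ := by
  constructor
  · intro h θ
    have h0 : S.IsDeriv (φ - prim ψ) 0 := by simpa using h.sub (isDeriv_prim ψ)
    have := h0.eq_const θ
    simp only [ContinuousMap.sub_apply, prim_zero, sub_zero] at this
    rw [← this, sub_add_cancel]
  · intro h
    have : φ = ContinuousMap.const _ (φ S.pt0) + prim ψ := by ext1 θ; exact h θ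
    rw [this]
    simpa using (isDeriv_const (S := S) (φ S.pt0)).add (isDeriv_prim ψ)

theorem isClosed_isDeriv : IsClosed {q : S.X × S.X | S.IsDeriv q.1 q.2} := by
  simp only [isDeriv_iff, Set.ofPred_forall]
  refine isClosed_iInter fun θ => isClosed_eq ?_ (Continuous.add ?_ ?_)
  · exact (continuous_eval_const θ).comp continuous_fst
  · exact (continuous_eval_const _).comp continuous_fst
  · have : Continuous fun ψ : S.X => ∫ s in (0 : ℝ)..θ, Set.IccExtend S.neg_le_self ψ s := by
      refine intervalIntegral.continuous_parametric_intervalIntegral_of_continuous' ?_ _ _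
      have h2 : Continuous fun q : S.X × ℝ =>
          q.1 (Set.projIcc (-S.τmax) S.τmax S.neg_le_self q.2) := by fun_prop
      exact h2
    exact this.comp continuous_snd

theorem continuous_boundary : Continuous S.boundary := by
  unfold boundary
  refine Continuous.add ?_ (continuous_finsetSum _ fun k _ => Continuous.add ?_ ?_)
  all_goals
    exact (Continuous.matrix_mulVec continuous_const (continuous_eval_const _))

/-- `φ ∈ D(𝓗)` and `𝓗 φ = ψ`. -/
def HasH (φ ψ : S.X) : Prop := S.IsDeriv φ ψ ∧ ψ S.pt0 = S.boundary φ

theorem HasH.unique {φ ψ ψ' : S.X} (h : HasH φ ψ) (h' : HasH φ ψ') : ψ = ψ' := h.1.unique h'.1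

theorem HasH.add {φ φ' ψ ψ' : S.X} (h : HasH φ ψ) (h' : HasH φ' ψ') :
    HasH (φ + φ') (ψ + ψ') :=
  ⟨h.1.add h'.1, by rw [boundary_add, ContinuousMap.add_apply, h.2, h'.2]⟩

theorem HasH.smul {φ ψ : S.X} (c : ℂ) (h : HasH φ ψ) : HasH (c • φ) (c • ψ) :=
  ⟨h.1.smul c, by rw [boundary_smul, ContinuousMap.smul_apply, h.2]⟩

theorem HasH.sub {φ φ' ψ ψ' : S.X} (h : HasH φ ψ) (h' : HasH φ' ψ') :
    HasH (φ - φ') (ψ - ψ') := by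
  have e : ∀ a b : S.X, a - b = a + (-1 : ℂ) • b := fun a b => by module
  rw [e, e]
  exact h.add (h'.smul (-1))

theorem hasH_zero : HasH (0 : S.X) 0 := ⟨isDeriv_zero, by simp [boundary]⟩

theorem isClosed_hasH : IsClosed {q : S.X × S.X | HasH q.1 q.2} := by
  refine isClosed_isDeriv.inter (isClosed_eq ?_ (continuous_boundary.comp continuous_fst))
  exact (continuous_eval_const _).comp continuous_snd

theorem hasH_opH (φ : S.opH.domain) : HasH (φ : S.X) (S.opH φ) :=
  ⟨S.derivH_spec φ, by
    obtain ⟨ψ, hψ⟩ := φ.2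
    rw [show S.opH φ = ψ from (S.derivH_spec φ).unique hψ.1]
    exact hψ.2⟩

theorem opH_apply_eq_iff {φ ψ : S.X} (h : φ ∈ S.opH.domain) :
    S.opH ⟨φ, h⟩ = ψ ↔ HasH φ ψ :=
  ⟨fun e => e ▸ hasH_opH ⟨φ, h⟩, fun e => (hasH_opH ⟨φ, h⟩).unique e⟩

theorem exists_opH_eq_iff {φ ψ : S.X} : (∃ h : φ ∈ S.opH.domain, S.opH ⟨φ, h⟩ = ψ) ↔ HasH φ ψ :=
  ⟨fun ⟨h, e⟩ => (opH_apply_eq_iff h).1 e, fun h => ⟨⟨_, h⟩, (opH_apply_eq_iff _).2 h⟩⟩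

theorem isEigenvector_opH_iff {z : ℂ} {φ : S.X} :
    IsEigenvector S.opH z φ ↔ φ ≠ 0 ∧ HasH φ (z • φ) :=
  and_congr_right fun _ => exists_opH_eq_iff

theorem opR_eq_iff {σ : ℂ} {φ f : S.X} :
    (∃ h : φ ∈ (S.opR σ).domain, S.opR σ ⟨φ, h⟩ = f) ↔
      ∃ ψ χ : S.X, HasH φ ψ ∧ HasH ψ χ ∧ χ - σ ^ 2 • φ = f := by
  have := product_shift_eq_iff S.opH σ φ f
  simp only [exists_opH_eq_iff] at this
  exact this

/-- Equicontinuous bounded sets in `X` are relatively compact. -/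
theorem isCompact_lipschitz_ball (C : NNReal) :
    IsCompact {φ : S.X | (∀ θ, ‖φ θ‖ ≤ C) ∧ LipschitzWith C φ} := by
  refine ArzelaAscoli.isCompact_of_equicontinuous _ ?_ ?_
  -- For an equicontinuous family, compactness for pointwise convergence suffices; there the set is
  -- closed in a product of balls.
  · have : ContinuousMap.toFun '' {φ : S.X | (∀ θ, ‖φ θ‖ ≤ C) ∧ LipschitzWith C φ} =
        Set.pi Set.univ (fun _ => Metric.closedBall (0 : Fin n ⊕ Fin n → ℂ) C) ∩
          {g : S.Interval → Fin n ⊕ Fin n → ℂ | LipschitzWith C g} := by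
      ext g
      constructor
      · rintro ⟨φ, hφ, rfl⟩
        exact ⟨fun θ _ => by simpa using hφ.1 θ, hφ.2⟩
      · rintro ⟨h1, h2⟩
        exact ⟨⟨g, h2.continuous⟩, ⟨fun θ => by simpa using h1 θ trivial, h2⟩, rfl⟩
    rw [this]
    refine (isCompact_univ_pi fun _ => isCompact_closedBall _ _).inter_right ?_
    simp only [lipschitzWith_iff_dist_le_mul, Set.ofPred_forall]
    refine isClosed_iInter fun x => isClosed_iInter fun y => isClosed_le ?_ continuous_const
    fun_prop
  · exact (LipschitzWith.uniformEquicontinuous _ C fun φ => φ.2.2).equicontinuous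

end DelaySystem

/-! ### Exponentials in a commutative Banach algebra -/

section Exponential

variable {A : Type*} [NormedCommRing A] [NormedAlgebra ℂ A]

/-- The exponential `e^{θx}` in a commutative Banach algebra. -/
def expAt (x : A) (θ : ℝ) : A := NormedSpace.exp ((θ : ℂ) • x)

theorem expAt_zero (x : A) : expAt x 0 = 1 := by simp [expAt]

theorem expAt_neg (x : A) (θ : ℝ) : expAt (-x) θ = expAt x (-θ) := by simp [expAt]

variable [CompleteSpace A]

theorem hasDerivAt_clm_expAt {F : Type*} [NormedAddCommGroup F] [NormedSpace ℂ F]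
    (t : A →L[ℂ] F) (x a : A) (θ : ℝ) :
    HasDerivAt (fun s : ℝ => t (expAt x s * a)) (t (expAt x θ * (x * a))) θ := by
  have h1 := (hasDerivAt_exp_smul_const (𝕂 := ℂ) x (θ : ℂ)).mul_const a
  have h2 := (t.hasFDerivAt.comp_hasDerivAt (θ : ℂ) h1)
  have h3 := h2.scomp θ (Complex.ofRealCLM.hasDerivAt (x := θ))
  simpa [expAt, mul_assoc, Function.comp_def] using h3

theorem expAt_neg_mul_expAt (x : A) (θ : ℝ) : expAt x (-θ) * expAt x θ = 1 := by
  let : NormedAlgebra ℚ A := NormedAlgebra.restrictScalars ℚ ℂ A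
  rw [expAt, expAt, ← NormedSpace.exp_add]
  simp

end Exponential

/-! ### The characteristic matrix over an algebra and exponential functions -/

namespace DelaySystem

variable {n K : ℕ} (S : DelaySystem n K)

section Characteristic

variable {A : Type*} [NormedCommRing A] [NormedAlgebra ℂ A]

/-- The real numbers as elements of a complex algebra. -/
def ofRealAlg (A : Type*) [NormedCommRing A] [NormedAlgebra ℂ A] : ℝ →+* A :=
  (algebraMap ℂ A).comp Complex.ofRealHom

/-- The characteristic matrix `x - H₀ - ∑ₖ (H₋ₖ e^{-τₖ x} + Hₖ e^{τₖ x})` at an element `x` of a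
commutative Banach algebra. -/
def charMat (x : A) : Matrix (Fin n ⊕ Fin n) (Fin n ⊕ Fin n) A :=
  x • 1 - S.H0.map (ofRealAlg A) -
    ∑ k, (expAt x (-S.τ k) • (S.Hneg k).map (ofRealAlg A) +
      expAt x (S.τ k) • (S.Hpos k).map (ofRealAlg A))

theorem J_transpose (n : ℕ) : (J n)ᵀ = -J n := by
  simp [J, Matrix.fromBlocks_transpose, Matrix.fromBlocks_neg]

theorem J_mul_J (n : ℕ) : J n * J n = -1 := by
  simp [J, Matrix.fromBlocks_multiply, ← Matrix.fromBlocks_one, Matrix.fromBlocks_neg]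

/-- The matrix `J` over a complex algebra. -/
def JA (A : Type*) [NormedCommRing A] [NormedAlgebra ℂ A] (n : ℕ) :
    Matrix (Fin n ⊕ Fin n) (Fin n ⊕ Fin n) A := (J n).map (ofRealAlg A)

theorem JA_mul_JA (n : ℕ) : JA A n * JA A n = -1 := by
  rw [JA, ← Matrix.map_mul, J_mul_J]
  ext i j
  by_cases h : i = j <;> simp [h]

theorem JA_transpose (n : ℕ) : (JA A n)ᵀ = -JA A n := by
  rw [JA, ← Matrix.transpose_map, J_transpose]
  ext i j
  simp

theorem transpose_JA_mul_map {P Q : Matrix (Fin n ⊕ Fin n) (Fin n ⊕ Fin n) ℝ}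
    (h : (J n * P)ᵀ = J n * Q) :
    (JA A n * P.map (ofRealAlg A))ᵀ = JA A n * Q.map (ofRealAlg A) := by
  rw [JA, ← Matrix.map_mul, ← Matrix.transpose_map, h, Matrix.map_mul]

/-- The Hamiltonian symmetry of the characteristic matrix. -/
theorem transpose_JA_mul_charMat (x : A) :
    (JA A n * S.charMat x)ᵀ = JA A n * S.charMat (-x) := by
  have hpos : ∀ k, (JA A n * (S.Hpos k).map (ofRealAlg A))ᵀ =
      JA A n * (S.Hneg k).map (ofRealAlg A) := fun k =>
    transpose_JA_mul_map (by rw [← S.hamiltonian_delay k, Matrix.transpose_transpose])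
  simp only [charMat, mul_sub, Matrix.mul_sum, mul_add, Matrix.mul_smul, mul_one,
    Matrix.transpose_sub, Matrix.transpose_sum, Matrix.transpose_add, Matrix.transpose_smul,
    JA_transpose, hpos, transpose_JA_mul_map S.hamiltonian_zero,
    fun k => transpose_JA_mul_map (A := A) (S.hamiltonian_delay k), expAt_neg, neg_neg,
    smul_neg, neg_smul, mul_neg]
  refine congrArg₂ _ rfl (Finset.sum_congr rfl fun k _ => ?_)
  rw [add_comm]

theorem JA_mulVec_eq_zero_iff {v : Fin n ⊕ Fin n → A} : JA A n *ᵥ v = 0 ↔ v = 0 := by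
  refine ⟨fun h => ?_, fun h => by rw [h, Matrix.mulVec_zero]⟩
  have : (JA A n * JA A n) *ᵥ v = 0 := by rw [← Matrix.mulVec_mulVec, h, Matrix.mulVec_zero]
  simpa [JA_mul_JA, Matrix.neg_mulVec] using this

theorem det_JA_ne_zero : (JA ℂ n).det ≠ 0 := by
  intro h
  have := congrArg Matrix.det (JA_mul_JA (A := ℂ) n)
  rw [Matrix.det_mul, h, Matrix.det_neg, Matrix.det_one] at this
  simp at this

theorem det_charMat_neg_eq_zero_iff (z : ℂ) :
    (S.charMat (-z)).det = 0 ↔ (S.charMat z).det = 0 := by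
  have := congrArg Matrix.det (S.transpose_JA_mul_charMat z)
  rw [Matrix.det_transpose, Matrix.det_mul, Matrix.det_mul] at this
  rw [mul_left_cancel₀ det_JA_ne_zero this]

theorem ofReal_mul_clm (t : A →L[ℂ] ℂ) (r : ℝ) (a : A) :
    (r : ℂ) * t a = t (ofRealAlg A r * a) := by
  have : ofRealAlg A r * a = (r : ℂ) • a := by
    rw [Algebra.smul_def]; rfl
  rw [this, map_smul, smul_eq_mul]

variable [CompleteSpace A]

/-- The function `θ ↦ t(e^{θx} aᵢ)`. -/
def expFun (t : A →L[ℂ] ℂ) (x : A) (a : Fin n ⊕ Fin n → A) : S.X where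
  toFun θ i := t (expAt x θ * a i)
  continuous_toFun := by
    refine continuous_pi fun i => ?_
    have : Continuous fun s : ℝ => t (expAt x s * a i) :=
      continuous_iff_continuousAt.2 fun s => (hasDerivAt_clm_expAt t x (a i) s).continuousAt
    exact this.comp continuous_subtype_val

variable {S}

theorem expFun_apply (t : A →L[ℂ] ℂ) (x : A) (a : Fin n ⊕ Fin n → A) (θ : S.Interval)
    (i : Fin n ⊕ Fin n) : S.expFun t x a θ i = t (expAt x θ * a i) := rfl

theorem expFun_pt0 (t : A →L[ℂ] ℂ) (x : A) (a : Fin n ⊕ Fin n → A)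
    (i : Fin n ⊕ Fin n) : S.expFun t x a S.pt0 i = t (a i) := by
  rw [expFun_apply, show ((S.pt0 : S.Interval) : ℝ) = 0 from rfl, expAt_zero, one_mul]

theorem isDeriv_expFun (t : A →L[ℂ] ℂ) (x : A) (a : Fin n ⊕ Fin n → A) :
    S.IsDeriv (S.expFun t x a) (S.expFun t x (x • a)) :=
  isDeriv_of_hasDerivAt (f := fun s i => t (expAt x s * a i)) (fun _ => rfl) fun θ =>
    hasDerivAt_pi.2 fun i => hasDerivAt_clm_expAt t x (a i) θ

theorem map_mulVec_expFun (t : A →L[ℂ] ℂ) (x : A) (a : Fin n ⊕ Fin n → A)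
    (P : Matrix (Fin n ⊕ Fin n) (Fin n ⊕ Fin n) ℝ) (θ : S.Interval) (i : Fin n ⊕ Fin n) :
    (P.map Complex.ofReal *ᵥ S.expFun t x a θ) i =
      t (((expAt x θ • P.map (ofRealAlg A)) *ᵥ a) i) := by
  simp only [Matrix.mulVec, dotProduct, Matrix.map_apply, expFun_apply, Matrix.smul_apply,
    map_sum, ofReal_mul_clm, smul_eq_mul]
  exact Finset.sum_congr rfl fun j _ => by congr 1; ring

theorem boundary_expFun (t : A →L[ℂ] ℂ) (x : A) (a : Fin n ⊕ Fin n → A)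
    (i : Fin n ⊕ Fin n) :
    S.boundary (S.expFun t x a) i = t (x * a i - (S.charMat x *ᵥ a) i) := by
  have h0 := map_mulVec_expFun (S := S) t x a S.H0 S.pt0 i
  rw [show ((S.pt0 : S.Interval) : ℝ) = 0 from rfl, expAt_zero, one_smul] at h0
  have h1 : (S.charMat x *ᵥ a) i = x * a i - (S.H0.map (ofRealAlg A) *ᵥ a) i -
      ∑ k, (((expAt x (-S.τ k) • (S.Hneg k).map (ofRealAlg A)) *ᵥ a) i +
        ((expAt x (S.τ k) • (S.Hpos k).map (ofRealAlg A)) *ᵥ a) i) := by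
    simp only [charMat, Matrix.sub_mulVec, Matrix.sum_mulVec, Matrix.add_mulVec, Pi.sub_apply,
      Finset.sum_apply, Pi.add_apply]
    rw [Matrix.smul_mulVec, Matrix.one_mulVec, Pi.smul_apply, smul_eq_mul]
  rw [h1]
  simp only [boundary, Pi.add_apply, Finset.sum_apply, h0, map_mulVec_expFun]
  rw [← sub_add, sub_sub_cancel, map_add, map_sum]
  simp only [map_add]
  rfl

/-- The derivative is automatic. At `0` the boundary condition reads `t(x aᵢ) = t(x aᵢ - (M(x)
a)ᵢ)`. -/
theorem hasH_expFun_iff (t : A →L[ℂ] ℂ) (x : A) (a : Fin n ⊕ Fin n → A) :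
    HasH (S.expFun t x a) (S.expFun t x (x • a)) ↔ ∀ i, t ((S.charMat x *ᵥ a) i) = 0 := by
  rw [HasH, and_iff_right (isDeriv_expFun t x a), funext_iff]
  refine forall_congr' fun i => ?_
  rw [expFun_pt0, boundary_expFun, map_sub, Pi.smul_apply, smul_eq_mul, eq_comm, sub_eq_self]

/-- The `b` for which `b • a` gives the zero function form a subspace that contains `1` and, by
differentiation, is stable under `x`; it is therefore all of `A`. Evaluation at `0` gives `t(b aᵢ) =
0` for every `b`. -/
theorem expFun_injective (t : A →L[ℂ] ℂ) (ht : ∀ a, (∀ b, t (b * a) = 0) → a = 0) (x : A)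
    (hx : ∀ s : Submodule ℂ A, 1 ∈ s → (∀ a ∈ s, x * a ∈ s) → s = ⊤)
    {a : Fin n ⊕ Fin n → A} (ha : S.expFun t x a = 0) : a = 0 := by
  funext i
  let s : Submodule ℂ A :=
    { carrier := {b | S.expFun t x (b • a) = 0}
      add_mem' := fun {b c} hb hc => by
        ext θ j
        have h1 := congrFun (DFunLike.congr_fun hb θ) j
        have h2 := congrFun (DFunLike.congr_fun hc θ) j
        simp only [expFun_apply, Pi.smul_apply, smul_eq_mul, ContinuousMap.zero_apply,
          Pi.zero_apply] at h1 h2 ⊢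
        rw [add_mul, mul_add, map_add, h1, h2, add_zero]
      zero_mem' := by ext θ j; simp [expFun_apply]
      smul_mem' := fun c b hb => by
        ext θ j
        have h1 := congrFun (DFunLike.congr_fun hb θ) j
        simp only [expFun_apply, Pi.smul_apply, smul_eq_mul, ContinuousMap.zero_apply,
          Pi.zero_apply] at h1 ⊢
        rw [smul_mul_assoc, mul_smul_comm, map_smul, h1, smul_zero] }
  have hs : s = ⊤ := hx s (by simpa [s] using ha) fun b hb => by
    have hb' : S.expFun t x (b • a) = 0 := hb
    have := isDeriv_expFun (S := S) t x (b • a)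
    rw [hb', ← mul_smul] at this
    exact this.unique isDeriv_zero
  refine ht _ fun b => ?_
  have hb : S.expFun t x (b • a) = 0 := by
    have : b ∈ s := hs ▸ Submodule.mem_top
    exact this
  have := congrFun (DFunLike.congr_fun hb S.pt0) i
  rwa [expFun_pt0] at this

variable [FiniteDimensional ℂ A]

/-- If `x` acts on a family of functions as differentiation, the functions are exponentials. -/
theorem apply_eq_of_isDeriv (x : A) (g : A →ₗ[ℂ] S.X) (hg : ∀ a, S.IsDeriv (g a) (g (x * a)))
    (a : A) (θ : S.Interval) : g a θ = g (expAt x θ * a) S.pt0 := by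
  let b := Module.finBasis ℂ A
  have hsum : ∀ (c : A), ∑ k, b.repr c k • g (b k) = g c := fun c => by
    conv_rhs => rw [← b.sum_repr c]
    simp only [map_sum, map_smul]
  let e (k) : A →L[ℂ] ℂ := LinearMap.toContinuousLinearMap (b.coord k)
  -- The function `θ ↦ g(e^{-θx} a)(θ)` has zero derivative, hence is constant. Expansion in a basis
  -- of `A` makes it a finite sum to which the product rule applies.
  have key : ∀ a : A, ∀ θ : S.Interval, g (expAt x (-θ) * a) θ = g a S.pt0 := by
    intro a
    let f (k) (s : ℝ) : ℂ := e k (expAt x (-s) * a)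
    have hf : ∀ k s, HasDerivAt (f k) (e k (expAt x (-s) * (-x * a))) s := fun k s => by
      have := hasDerivAt_clm_expAt (e k) (-x) a s
      simpa only [expAt_neg] using this
    let F : S.X := ∑ k, ⟨fun θ => f k θ • g (b k) θ, by
      have : Continuous (f k) := continuous_iff_continuousAt.2 fun s => (hf k s).continuousAt
      fun_prop⟩
    have hF : ∀ θ, F θ = g (expAt x (-θ) * a) θ := fun θ => by
      rw [← hsum]
      simp [F, f, e]
    have hF' : S.IsDeriv F 0 := by
      intro θ
      have h1 : HasDerivWithinAt
          (fun s => ∑ k, f k s • Set.IccExtend S.neg_le_self (g (b k)) s)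
          (∑ k, (f k θ • g (x * b k) θ + e k (expAt x (-θ) * (-x * a)) • g (b k) θ))
          S.Interval θ := by
        refine HasDerivWithinAt.fun_sum fun k _ => ?_
        have := ((hf k θ).hasDerivWithinAt (s := S.Interval)).smul (hg (b k) θ)
        rw [Set.IccExtend_val] at this
        exact this
      have h2 : (∑ k, (f k θ • g (x * b k) θ + e k (expAt x (-θ) * (-x * a)) • g (b k) θ)) =
          (0 : S.X) θ := by
        have h3 := hsum (expAt x (-θ) * (-x * a))
        have h4 : ∑ k, b.repr (expAt x (-θ) * a) k • g (x * b k) = g (x * (expAt x (-θ) * a)) := by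
          conv_rhs => rw [← b.sum_repr (expAt x (-θ) * a)]
          simp only [Finset.mul_sum, mul_smul_comm, map_sum, map_smul]
        have h5 : g (x * (expAt x (-θ) * a)) + g (expAt x (-θ) * (-x * a)) = 0 := by
          rw [← map_add, ← map_zero g]
          congr 1
          ring
        rw [← h3, ← h4, ← Finset.sum_add_distrib] at h5
        have h6 := DFunLike.congr_fun h5 θ
        rw [← h6]
        simp [f, e]
      rw [h2] at h1
      refine h1.congr (fun s hs => ?_) ?_
      · rw [Set.IccExtend_of_mem _ _ hs]
        simp only [F, ContinuousMap.sum_apply, ContinuousMap.coe_mk]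
        exact Finset.sum_congr rfl fun k _ => by rw [Set.IccExtend_of_mem _ _ hs]
      · simp [F, Set.IccExtend_val]
    intro θ
    rw [← hF, hF'.eq_const, hF, show ((S.pt0 : S.Interval) : ℝ) = 0 from rfl, neg_zero,
      expAt_zero, one_mul]
  rw [← key (expAt x θ * a) θ, ← mul_assoc, expAt_neg_mul_expAt, one_mul]

/-- Families on which `x` acts as `𝓗` come from the kernel of the characteristic matrix. -/
theorem eq_expFun_of_hasH (t : A →L[ℂ] ℂ) (ht : ∀ a, (∀ b, t (b * a) = 0) → a = 0) (x : A)
    (g : A →ₗ[ℂ] S.X) (hg : ∀ a, HasH (g a) (g (x * a))) (b : Fin n ⊕ Fin n → A)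
    (hb : ∀ a i, g a S.pt0 i = t (a * b i)) :
    g 1 = S.expFun t x b ∧ S.charMat x *ᵥ b = 0 := by
  have h : ∀ a, g a = S.expFun t x (a • b) := fun a => by
    ext θ i
    rw [apply_eq_of_isDeriv x g (fun a => (hg a).1), hb, expFun_apply, Pi.smul_apply,
      smul_eq_mul, mul_assoc]
  refine ⟨by rw [h, one_smul], funext fun i => ht _ fun a => ?_⟩
  have := hg a
  rw [h, h, mul_smul, hasH_expFun_iff] at this
  simpa [Matrix.mulVec_smul] using this i

end Characteristic

end DelaySystem

/-! ### Spectrum of `𝓗` and solvability of `𝓗φ - zφ = f` -/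

namespace DelaySystem

variable {n K : ℕ} {S : DelaySystem n K}

/-- This is the calculus above with `A = ℂ` and `t = id`. -/
theorem isEigenvalue_iff_det {z : ℂ} : IsEigenvalue S.opH z ↔ (S.charMat z).det = 0 := by
  rw [← Matrix.exists_mulVec_eq_zero_iff]
  constructor
  · rintro ⟨φ, hφ⟩
    obtain ⟨hφ0, hφ⟩ := isEigenvector_opH_iff.1 hφ
    obtain ⟨h1, h2⟩ := eq_expFun_of_hasH (ContinuousLinearMap.id ℂ ℂ)
      (fun a ha => by simpa using ha 1) z (LinearMap.toSpanSingleton ℂ S.X φ)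
      (fun a => by
        have := hφ.smul a
        rwa [smul_smul, mul_comm a z] at this) (φ S.pt0) (fun a i => rfl)
    rw [LinearMap.toSpanSingleton_apply, one_smul] at h1
    refine ⟨_, fun h0 => hφ0 ?_, h2⟩
    rw [h1, h0]
    ext θ i
    simp [expFun_apply]
  · rintro ⟨v, hv, hM⟩
    refine ⟨S.expFun (ContinuousLinearMap.id ℂ ℂ) z v, isEigenvector_opH_iff.2 ⟨fun h => hv ?_, ?_⟩⟩
    · funext i
      have := congrFun (DFunLike.congr_fun h S.pt0) i
      rwa [expFun_pt0] at this
    · have e : z • S.expFun (ContinuousLinearMap.id ℂ ℂ) z v =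
          S.expFun (ContinuousLinearMap.id ℂ ℂ) z (z • v) := by
        ext θ i
        simp only [ContinuousMap.smul_apply, Pi.smul_apply, expFun_apply, smul_eq_mul,
          ContinuousLinearMap.id_apply]
        ring
      rw [e, hasH_expFun_iff, hM]
      simp

theorem isEigenvalue_neg {z : ℂ} (h : IsEigenvalue S.opH z) : IsEigenvalue S.opH (-z) := by
  rw [isEigenvalue_iff_det] at h ⊢
  exact (S.det_charMat_neg_eq_zero_iff z).2 h

theorem eq_zero_of_hasH {z : ℂ} (hz : ¬ IsEigenvalue S.opH z) {φ : S.X}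
    (h : HasH φ (z • φ)) : φ = 0 := by
  by_contra h0
  exact hz ⟨φ, isEigenvector_opH_iff.2 ⟨h0, h⟩⟩

/-- A particular solution of `φ' = z φ + f`. -/
theorem exists_isDeriv_smul_add (z : ℂ) (f : S.X) : ∃ φ : S.X, S.IsDeriv φ (z • φ + f) := by
  let e : C(S.Interval, ℂ) := ⟨fun θ => Complex.exp (z * (θ : ℝ)), by fun_prop⟩
  let e' : C(S.Interval, ℂ) := ⟨fun θ => Complex.exp (-(z * (θ : ℝ))), by fun_prop⟩
  -- Variation of constants: `φ(θ) = e^{zθ} ∫₀^θ e^{-zs} f(s) ds`.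
  let φ : S.X := ⟨fun θ => e θ • prim ⟨fun θ => e' θ • f θ, by fun_prop⟩ θ, by fun_prop⟩
  refine ⟨φ, fun θ => ?_⟩
  have h1 : HasDerivAt (fun s : ℝ => Complex.exp (z * s)) (Complex.exp (z * (θ : ℝ)) * z) θ := by
    have := (((hasDerivAt_id ((θ : ℝ) : ℂ)).const_mul z).cexp).comp_ofReal
    simpa using this
  have h2 := h1.hasDerivWithinAt (s := S.Interval) |>.smul
    (isDeriv_prim (S := S) ⟨fun θ => e' θ • f θ, by fun_prop⟩ θ)
  rw [Set.IccExtend_val] at h2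
  have h3 : HasDerivWithinAt (Set.IccExtend S.neg_le_self φ) _ S.Interval θ :=
    h2.congr (fun s hs => ?_) ?_
  · convert h3 using 1
    simp only [ContinuousMap.add_apply, ContinuousMap.smul_apply, ContinuousMap.coe_mk, φ, e, e',
      smul_smul, ← Complex.exp_add]
    rw [add_neg_cancel, Complex.exp_zero, one_smul, add_comm, mul_comm]
  · rw [Set.IccExtend_of_mem _ _ hs]
    simp only [φ, e, ContinuousMap.coe_mk, Pi.smul_apply']
    rw [Set.IccExtend_of_mem _ _ hs]
  · simp only [φ, e, Set.IccExtend_val, ContinuousMap.coe_mk, Pi.smul_apply']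

/-- `𝓗 - z I` maps `D(𝓗)` onto `X` if `z` is not an eigenvalue. -/
theorem exists_hasH_of_not_isEigenvalue {z : ℂ} (hz : ¬ IsEigenvalue S.opH z) (f : S.X) :
    ∃ φ : S.X, HasH φ (z • φ + f) := by
  rw [isEigenvalue_iff_det] at hz
  obtain ⟨φ, hφ⟩ := exists_isDeriv_smul_add z f
  have hu : IsUnit (S.charMat z).det := isUnit_iff_ne_zero.2 hz
  -- `r` is the defect of `φ` in the boundary condition; adding `e^{zθ} c` with `M(z) c = r` removes
  -- it.
  let r : Fin n ⊕ Fin n → ℂ := S.boundary φ - (z • φ + f) S.pt0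
  let c : Fin n ⊕ Fin n → ℂ := (S.charMat z)⁻¹ *ᵥ r
  have hc : S.charMat z *ᵥ c = r := by
    rw [Matrix.mulVec_mulVec, Matrix.mul_nonsing_inv _ hu, Matrix.one_mulVec]
  let η := S.expFun (ContinuousLinearMap.id ℂ ℂ) z c
  have hη : S.expFun (ContinuousLinearMap.id ℂ ℂ) z (z • c) = z • η := by
    ext θ i
    simp only [ContinuousMap.smul_apply, Pi.smul_apply, expFun_apply, smul_eq_mul,
      ContinuousLinearMap.id_apply, η]
    ring
  have hηd : S.IsDeriv η (z • η) := hη ▸ isDeriv_expFun _ _ _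
  have e : z • (φ + η) + f = (z • φ + f) + z • η := by module
  refine ⟨φ + η, ?_, ?_⟩
  · rw [e]; exact hφ.add hηd
  · rw [e, boundary_add]
    funext i
    have h1 := boundary_expFun (S := S) (ContinuousLinearMap.id ℂ ℂ) z c i
    have h2 : (z • η) S.pt0 i = z * c i := by
      rw [← hη, expFun_pt0]; rfl
    rw [hc] at h1
    rw [ContinuousMap.add_apply, Pi.add_apply, Pi.add_apply, h1, h2]
    simp only [ContinuousLinearMap.id_apply, r, Pi.sub_apply]
    ring

/-! ### The inverse of `𝓡_σ`: spectrum, eigenspaces, compactness -/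

section Inverse

variable {σ : ℂ} (hσ : ¬ IsEigenvalue S.opH σ)

include hσ

theorem not_isEigenvalue_neg : ¬ IsEigenvalue S.opH (-σ) := fun h =>
  hσ (by simpa using isEigenvalue_neg h)

/-- `𝓡_σ φ = f` has a solution. -/
theorem exists_solution (f : S.X) :
    ∃ φ ψ χ : S.X, HasH φ ψ ∧ HasH ψ χ ∧ χ - σ ^ 2 • φ = f := by
  obtain ⟨η, hη⟩ := exists_hasH_of_not_isEigenvalue hσ f
  obtain ⟨φ, hφ⟩ := exists_hasH_of_not_isEigenvalue (not_isEigenvalue_neg hσ) η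
  refine ⟨φ, _, _, hφ, (hφ.smul (-σ)).add hη, ?_⟩
  module

theorem solution_unique {φ ψ χ : S.X} (h1 : HasH φ ψ) (h2 : HasH ψ χ)
    (h3 : χ - σ ^ 2 • φ = 0) : φ = 0 := by
  -- `ψ + σφ = (𝓗 + σ)φ` lies in the kernel of `𝓗 - σ`.
  have h4 : ψ + σ • φ = 0 := by
    refine eq_zero_of_hasH hσ ?_
    convert h2.add (h1.smul σ) using 1
    rw [sub_eq_zero.1 h3]
    module
  refine eq_zero_of_hasH (not_isEigenvalue_neg hσ) ?_
  have e : -σ • φ = ψ := by linear_combination (norm := module) -h4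
  rwa [e]

theorem bijective_opR : Function.Bijective (S.opR σ).toFun := by
  constructor
  · refine (injective_iff_map_eq_zero _).2 fun φ hφ => ?_
    obtain ⟨ψ, χ, h1, h2, h3⟩ := opR_eq_iff.1 ⟨φ.2, hφ⟩
    exact Subtype.ext (solution_unique hσ h1 h2 h3)
  · intro f
    obtain ⟨φ, ψ, χ, h⟩ := exists_solution hσ f
    obtain ⟨h', e⟩ := opR_eq_iff.2 ⟨ψ, χ, h⟩
    exact ⟨⟨φ, h'⟩, e⟩

theorem opRinv_eq_iff {φ f : S.X} :
    S.opRinv σ f = φ ↔ ∃ ψ χ : S.X, HasH φ ψ ∧ HasH ψ χ ∧ χ - σ ^ 2 • φ = f := by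
  have hb := bijective_opR hσ
  have e : S.opRinv σ f = ((LinearEquiv.ofBijective (S.opR σ).toFun hb).symm f : S.X) := by
    rw [opRinv, inverse, dif_pos hb]
    rfl
  rw [e, ← opR_eq_iff]
  constructor
  · rintro rfl
    exact ⟨Subtype.prop _, (LinearEquiv.ofBijective (S.opR σ).toFun hb).apply_symm_apply f⟩
  · rintro ⟨h, rfl⟩
    exact congrArg Subtype.val
      ((LinearEquiv.ofBijective (S.opR σ).toFun hb).symm_apply_apply ⟨φ, h⟩)

theorem opRinv_eq {φ ψ χ f : S.X} (h1 : HasH φ ψ) (h2 : HasH ψ χ) (h3 : χ - σ ^ 2 • φ = f) :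
    S.opRinv σ f = φ := (opRinv_eq_iff hσ).2 ⟨ψ, χ, h1, h2, h3⟩

/-- The operator `𝓗 𝓡_σ⁻¹`. -/
theorem exists_opH_comp_opRinv : ∃ U : S.X →ₗ[ℂ] S.X, ∀ f, HasH (S.opRinv σ f) (U f) ∧
    HasH (U f) (f + σ ^ 2 • S.opRinv σ f) := by
  have h : ∀ f, ∃ ψ, HasH (S.opRinv σ f) ψ ∧ HasH ψ (f + σ ^ 2 • S.opRinv σ f) := fun f => by
    obtain ⟨ψ, χ, h1, h2, h3⟩ := (opRinv_eq_iff hσ).1 (rfl : S.opRinv σ f = _)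
    refine ⟨ψ, h1, ?_⟩
    have e : f + σ ^ 2 • S.opRinv σ f = χ := by linear_combination (norm := module) -h3
    rwa [e]
  choose U hU1 hU2 using h
  refine ⟨⟨⟨U, fun f g => ?_⟩, fun c f => ?_⟩, fun f => ⟨hU1 f, hU2 f⟩⟩
  · refine (hU1 (f + g)).unique ?_
    rw [map_add]
    exact (hU1 f).add (hU1 g)
  · refine (hU1 (c • f)).unique ?_
    rw [map_smul]
    exact (hU1 f).smul c

theorem mem_eigenspace_iff {l : ℂ} (hl : l ^ 2 ≠ σ ^ 2) {φ : S.X} :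
    φ ∈ Module.End.eigenspace (S.opRinv σ) (1 / (l ^ 2 - σ ^ 2)) ↔
      ∃ ψ, HasH φ ψ ∧ HasH ψ (l ^ 2 • φ) := by
  have h0 : l ^ 2 - σ ^ 2 ≠ 0 := sub_ne_zero.2 hl
  rw [Module.End.mem_eigenspace_iff]
  constructor
  · intro h
    obtain ⟨ψ, χ, h1, h2, h3⟩ := (opRinv_eq_iff hσ).1 h
    refine ⟨(l ^ 2 - σ ^ 2) • ψ, ?_, ?_⟩
    · convert h1.smul (l ^ 2 - σ ^ 2) using 1
      rw [smul_smul, mul_one_div_cancel h0, one_smul]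
    · convert h2.smul (l ^ 2 - σ ^ 2) using 1
      have e : χ = (1 + σ ^ 2 * (1 / (l ^ 2 - σ ^ 2))) • φ := by
        linear_combination (norm := module) h3
      rw [e, smul_smul]
      congr 1
      field_simp
      ring
  · rintro ⟨ψ, h1, h2⟩
    have h3 : S.opRinv σ ((l ^ 2 - σ ^ 2) • φ) = φ := opRinv_eq hσ h1 h2 (by module)
    rw [map_smul] at h3
    rw [one_div, eq_inv_smul_iff₀ h0, h3]

/-- If `𝓗²φ = l²φ`, then `(𝓗 + l)φ` is either an eigenfunction for `l` or zero; in the latter case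
`φ` is one for `-l`, and the symmetry of the spectrum gives `l`. -/
theorem isEigenvalue_iff {l : ℂ} : IsEigenvalue S.opH l ↔
    l ^ 2 ≠ σ ^ 2 ∧ Module.End.HasEigenvalue (S.opRinv σ) (1 / (l ^ 2 - σ ^ 2)) := by
  constructor
  · intro hl
    have hne : l ^ 2 ≠ σ ^ 2 := by
      intro h
      rcases sq_eq_sq_iff_eq_or_eq_neg.1 h with rfl | rfl
      · exact hσ hl
      · exact not_isEigenvalue_neg hσ hl
    refine ⟨hne, ?_⟩
    obtain ⟨φ, hφ⟩ := hl
    obtain ⟨h0, hφ⟩ := isEigenvector_opH_iff.1 hφ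
    refine Module.End.hasEigenvalue_of_hasEigenvector (x := φ)
      ⟨(mem_eigenspace_iff hσ hne).2 ⟨_, hφ, ?_⟩, h0⟩
    convert hφ.smul l using 1
    rw [smul_smul, sq]
  · rintro ⟨hne, h⟩
    obtain ⟨φ, hφ, h0⟩ := h.exists_hasEigenvector
    obtain ⟨ψ, h1, h2⟩ := (mem_eigenspace_iff hσ hne).1 hφ
    have h3 : HasH (ψ + l • φ) (l • (ψ + l • φ)) := by
      convert h2.add (h1.smul l) using 1
      module
    by_cases h4 : ψ + l • φ = 0
    · have h5 : IsEigenvalue S.opH (-l) := by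
        refine ⟨φ, isEigenvector_opH_iff.2 ⟨h0, ?_⟩⟩
        have e : -l • φ = ψ := by linear_combination (norm := module) -h4
        rwa [e]
      simpa using isEigenvalue_neg h5
    · exact ⟨_, isEigenvector_opH_iff.2 ⟨h4, h3⟩⟩

theorem ne_zero_of_hasEigenvalue {μ : ℂ} (h : Module.End.HasEigenvalue (S.opRinv σ) μ) :
    μ ≠ 0 := by
  rintro rfl
  obtain ⟨φ, hφ, h0⟩ := h.exists_hasEigenvector
  have hφ' : S.opRinv σ φ = 0 := (Module.End.mem_eigenspace_iff.1 hφ).trans (by module)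
  obtain ⟨ψ, χ, h1, h2, h3⟩ := (opRinv_eq_iff hσ).1 hφ'
  apply h0
  have hψ := h1.unique hasH_zero
  subst hψ
  have hχ := h2.unique hasH_zero
  subst hχ
  rw [← h3]
  module

theorem isEigenvalue_of_hasEigenvalue {μ s : ℂ} (h : Module.End.HasEigenvalue (S.opRinv σ) μ)
    (hs : s ^ 2 = 1 / μ + σ ^ 2) : IsEigenvalue S.opH s := by
  have h0 := ne_zero_of_hasEigenvalue hσ h
  have e : s ^ 2 - σ ^ 2 = 1 / μ := by rw [hs]; ring
  refine (isEigenvalue_iff hσ).2 ⟨?_, ?_⟩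
  · rw [← sub_ne_zero, e]
    exact one_div_ne_zero h0
  · rwa [e, one_div_one_div]

omit hσ in
theorem mem_span_of_isSimpleEigenvalue {z : ℂ} {φ ψ : S.X} (hz : IsSimpleEigenvalue S.opH z)
    (hφ : IsEigenvector S.opH z φ) (hψ : HasH ψ (z • ψ)) : ψ ∈ Submodule.span ℂ {φ} := by
  have hmem : ∀ χ : S.X, HasH χ (z • χ) → χ ∈ maxGenEigenspace S.opH z := fun χ hχ => by
    refine Submodule.mem_iSup_of_mem 1 ?_
    have hd : χ ∈ S.opH.domain := ⟨_, hχ⟩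
    refine ⟨⟨χ, hd⟩, ?_, rfl⟩
    have e : shift S.opH (-z) ⟨χ, hd⟩ = 0 := by
      refine (shift_apply _ _ _ hd).trans ?_
      rw [(opH_apply_eq_iff hd).2 hχ]
      module
    exact e
  obtain ⟨h0, hφ⟩ := isEigenvector_opH_iff.1 hφ
  obtain ⟨c, hc⟩ := exists_smul_eq_of_finrank_eq_one hz.2 (x := ⟨φ, hmem φ hφ⟩)
    (fun h => h0 (congrArg Subtype.val h)) ⟨ψ, hmem ψ hψ⟩
  exact Submodule.mem_span_singleton.2 ⟨c, congrArg Subtype.val hc⟩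

/-- For `l ≠ 0`, `φ = ((𝓗 + l)φ - (𝓗 - l)φ) / (2l)` splits a solution of `𝓗²φ = l²φ` into its parts
for `l` and `-l`. -/
theorem eigenspace_eq_span {l : ℂ} {φp φm : S.X} (hl : l ≠ 0)
    (hlp : IsSimpleEigenvalue S.opH l) (hlm : IsSimpleEigenvalue S.opH (-l))
    (hp : IsEigenvector S.opH l φp) (hm : IsEigenvector S.opH (-l) φm) :
    Module.End.eigenspace (S.opRinv σ) (1 / (l ^ 2 - σ ^ 2)) = Submodule.span ℂ {φp, φm} := by
  have hne := ((isEigenvalue_iff hσ).1 hlp.1).1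
  have hsq : ∀ {z : ℂ} {φ : S.X}, z ^ 2 = l ^ 2 → IsEigenvector S.opH z φ →
      φ ∈ Module.End.eigenspace (S.opRinv σ) (1 / (l ^ 2 - σ ^ 2)) := fun {z φ} hz h => by
    have h' := (isEigenvector_opH_iff.1 h).2
    refine (mem_eigenspace_iff hσ hne).2 ⟨_, h', ?_⟩
    convert h'.smul z using 1
    rw [smul_smul, ← sq, hz]
  apply le_antisymm
  · intro φ hφ
    obtain ⟨ψ, h1, h2⟩ := (mem_eigenspace_iff hσ hne).1 hφ
    have h3 : HasH (ψ + l • φ) (l • (ψ + l • φ)) := by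
      convert h2.add (h1.smul l) using 1
      module
    have h4 : HasH (ψ - l • φ) (-l • (ψ - l • φ)) := by
      convert h2.sub (h1.smul l) using 1
      module
    have h5 := mem_span_of_isSimpleEigenvalue hlp hp h3
    have h6 := mem_span_of_isSimpleEigenvalue hlm hm h4
    have e : φ = (2 * l)⁻¹ • ((ψ + l • φ) - (ψ - l • φ)) := by
      have : (ψ + l • φ) - (ψ - l • φ) = (2 * l) • φ := by module
      rw [this, inv_smul_smul₀ (mul_ne_zero two_ne_zero hl)]
    rw [e]
    exact Submodule.smul_mem _ _ (Submodule.sub_mem _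
      (Submodule.span_mono (by simp) h5) (Submodule.span_mono (by simp) h6))
  · rw [Submodule.span_le]
    rintro φ (rfl | rfl)
    · exact hsq rfl hp
    · exact hsq (by ring) hm

/-- `𝓡_σ⁻¹` is a compact operator. -/
theorem isCompactOperator_opRinv : IsCompactOperator (S.opRinv σ) := by
  obtain ⟨U, hU⟩ := exists_opH_comp_opRinv hσ
  -- Since `𝓗` is closed, the graph of `f ↦ (𝓡_σ⁻¹ f, 𝓗 𝓡_σ⁻¹ f)` is closed, so this map is bounded.
  -- The unit ball then has images under `𝓡_σ⁻¹` that are uniformly bounded and uniformly Lipschitz.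
  let L : S.X →ₗ[ℂ] S.X × S.X := (S.opRinv σ).prod U
  have hL : Continuous L := by
    refine L.continuous_of_isClosed_graph ?_
    have : (L.graph : Set (S.X × (S.X × S.X))) =
        {q | HasH q.2.1 q.2.2 ∧ HasH q.2.2 (q.1 + σ ^ 2 • q.2.1)} := by
      ext ⟨f, φ, ψ⟩
      simp only [SetLike.mem_coe, LinearMap.mem_graph_iff, Set.mem_ofPred_eq]
      constructor
      · intro h
        obtain ⟨rfl, rfl⟩ := Prod.mk.inj h
        exact hU f
      · rintro ⟨h1, h2⟩
        have e := opRinv_eq hσ h1 h2 (f := f) (by module)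
        have h3 := (hU f).1
        rw [e] at h3
        simp [L, e, h3.unique h1]
    rw [this]
    refine IsClosed.inter ?_ ?_
    · exact isClosed_hasH.preimage continuous_snd
    · have : Continuous fun q : S.X × S.X × S.X => (q.2.2, q.1 + σ ^ 2 • q.2.1) := by fun_prop
      exact isClosed_hasH.preimage this
  obtain ⟨C, hC, hLC⟩ := (⟨L, hL⟩ : S.X →L[ℂ] S.X × S.X).isBoundedLinearMap.bound
  refine (isCompactOperator_iff_image_closedBall_subset_compact (S.opRinv σ) zero_lt_one).2
    ⟨_, isCompact_lipschitz_ball ⟨C, hC.le⟩, ?_⟩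
  rintro _ ⟨f, hf, rfl⟩
  have hf1 : ‖f‖ ≤ 1 := by simpa using hf
  have hb : ‖L f‖ ≤ C := (hLC f).trans (mul_le_of_le_one_right hC.le hf1)
  have hb1 : ‖S.opRinv σ f‖ ≤ C := (norm_fst_le (L f)).trans hb
  have hb2 : ‖U f‖ ≤ C := (norm_snd_le (L f)).trans hb
  refine ⟨fun θ => (ContinuousMap.norm_coe_le_norm _ θ).trans hb1, ?_⟩
  refine LipschitzWith.of_dist_le_mul fun θ θ' => ?_
  rw [dist_eq_norm]
  exact (hU f).1.1.norm_sub_le (fun θ => (ContinuousMap.norm_coe_le_norm _ θ).trans hb2) θ' θ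

end Inverse

end DelaySystem

/-! ### The Frobenius algebra `ℂ[X]/((X² - c)ʲ)` -/

section PolynomialQuotient

open Polynomial

variable {p : ℂ[X]} (hp : p.Monic)

/-- The coefficient of the highest power in `ℂ[X]/(p)`. -/
def topCoeff : AdjoinRoot p →ₗ[ℂ] ℂ :=
  (lcoeff ℂ (p.natDegree - 1)) ∘ₗ AdjoinRoot.modByMonicHom hp

theorem topCoeff_mk {f : ℂ[X]} (hf : f.degree < p.degree) :
    topCoeff hp (AdjoinRoot.mk p f) = f.coeff (p.natDegree - 1) := by
  rw [topCoeff, LinearMap.comp_apply, AdjoinRoot.modByMonicHom_mk,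
    (modByMonic_eq_self_iff hp).2 hf, lcoeff_apply]

include hp in
theorem exists_mk_eq (a : AdjoinRoot p) :
    ∃ f : ℂ[X], f.degree < p.degree ∧ AdjoinRoot.mk p f = a := by
  obtain ⟨f, rfl⟩ := AdjoinRoot.mk_surjective a
  refine ⟨f %ₘ p, degree_modByMonic_lt f hp, ?_⟩
  rw [← AdjoinRoot.modByMonicHom_mk hp, AdjoinRoot.mk_leftInverse hp]

/-- Multiplying a nonzero reduced representative by a suitable power of `X` moves its leading
coefficient to the top degree without any reduction. -/
theorem topCoeff_nondegenerate (a : AdjoinRoot p) (ha : ∀ b, topCoeff hp (b * a) = 0) : a = 0 := by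
  obtain ⟨f, hf, rfl⟩ := exists_mk_eq hp a
  by_contra h0
  have hf0 : f ≠ 0 := by rintro rfl; simp at h0
  have hd := natDegree_lt_natDegree hf0 hf
  have h := ha (AdjoinRoot.mk p (X ^ (p.natDegree - 1 - f.natDegree)))
  rw [← map_mul, topCoeff_mk, show p.natDegree - 1 =
    f.natDegree + (p.natDegree - 1 - f.natDegree) by omega, Nat.add_sub_cancel_left,
    coeff_X_pow_mul, coeff_natDegree, leadingCoeff_eq_zero] at h
  · exact hf0 h
  · rw [degree_mul, degree_X_pow, degree_eq_natDegree hf0, degree_eq_natDegree hp.ne_zero]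
    norm_cast
    omega

theorem eq_top_of_root_mul_mem (s : Submodule ℂ (AdjoinRoot p)) (h1 : 1 ∈ s)
    (hx : ∀ a ∈ s, AdjoinRoot.root p * a ∈ s) : s = ⊤ := by
  have hpow : ∀ k : ℕ, AdjoinRoot.root p ^ k ∈ s := fun k => by
    induction k with
    | zero => simpa using h1
    | succ k ih => rw [pow_succ']; exact hx _ ih
  refine eq_top_iff.2 fun a _ => ?_
  obtain ⟨f, rfl⟩ := AdjoinRoot.mk_surjective a
  rw [← AdjoinRoot.aeval_eq, aeval_eq_sum_range]
  exact Submodule.sum_mem _ fun k _ => s.smul_mem _ (hpow k)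

theorem coeff_comp_neg_X (f : ℂ[X]) (k : ℕ) : (f.comp (-X)).coeff k = (-1) ^ k * f.coeff k := by
  have : (-X : ℂ[X]) = C (-1) * X := by simp
  rw [this, comp_C_mul_X_coeff, mul_comm]

/-- The algebra `ℂ[X]/((X² - c)ʲ)` with its trace form and its involution `X ↦ -X`. -/
theorem exists_even_frobenius_algebra (c : ℂ) (j : ℕ) (hj : j ≠ 0) :
    ∃ (A : Type) (_ : NormedCommRing A) (_ : NormedAlgebra ℂ A) (_ : FiniteDimensional ℂ A)
      (x : A) (t : A →L[ℂ] ℂ) (bar : A →ₐ[ℂ] A),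
      (∀ a, (∀ b, t (b * a) = 0) → a = 0) ∧
      (∀ s : Submodule ℂ A, 1 ∈ s → (∀ a ∈ s, x * a ∈ s) → s = ⊤) ∧
      bar x = -x ∧ (∀ a, bar (bar a) = a) ∧ (∀ a, t (bar a) = -t a) ∧
      (x ^ 2 - algebraMap ℂ A c) ^ j = 0 ∧
      ∀ (M : Type) [AddCommGroup M] [Module ℂ M] (h : Module.End ℂ M),
        (h ^ 2 - c • (1 : Module.End ℂ M)) ^ j = 0 →
        ∃ ρ : A →ₐ[ℂ] Module.End ℂ M, ρ x = h := by
  let p : ℂ[X] := (X ^ 2 - C c) ^ j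
  have hp : p.Monic := (monic_X_pow_sub_C c two_ne_zero).pow j
  have hdeg : p.natDegree = 2 * j := by
    rw [natDegree_pow, natDegree_X_pow_sub_C, mul_comm]
  have hfin : FiniteDimensional ℂ (AdjoinRoot p) := (AdjoinRoot.powerBasis' hp).finite
  -- The norm is induced from the regular representation by matrices.
  let f := Algebra.leftMulMatrix (AdjoinRoot.powerBasis' hp).basis
  have hf : Function.Injective f := Algebra.leftMulMatrix_injective _
  let i1 : NormedRing (Matrix (Fin (AdjoinRoot.powerBasis' hp).dim)
    (Fin (AdjoinRoot.powerBasis' hp).dim) ℂ) := Matrix.linftyOpNormedRing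
  let i2 : NormedAlgebra ℂ (Matrix (Fin (AdjoinRoot.powerBasis' hp).dim)
    (Fin (AdjoinRoot.powerBasis' hp).dim) ℂ) := Matrix.linftyOpNormedAlgebra
  let i3 : NormedCommRing (AdjoinRoot p) := NormedCommRing.induced _ _ f hf
  let i4 : NormedAlgebra ℂ (AdjoinRoot p) := NormedAlgebra.induced ℂ _ _ f
  have hroot : (AdjoinRoot.root p ^ 2 - algebraMap ℂ (AdjoinRoot p) c) ^ j = 0 := by
    have := AdjoinRoot.mk_self (f := p)
    rw [show p = (X ^ 2 - C c) ^ j from rfl, map_pow, map_sub, map_pow, AdjoinRoot.mk_X,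
      AdjoinRoot.mk_C] at this
    exact this
  let bar : AdjoinRoot p →ₐ[ℂ] AdjoinRoot p :=
    AdjoinRoot.liftAlgHom p (Algebra.ofId ℂ _) (-AdjoinRoot.root p) (by
      have : aeval (-AdjoinRoot.root p) p = 0 := by
        simp only [p, map_pow, map_sub, aeval_X, aeval_C, neg_sq]
        exact hroot
      exact this)
  have hbar : bar (AdjoinRoot.root p) = -AdjoinRoot.root p := AdjoinRoot.liftAlgHom_root _ _ _ _
  have hbar_mk : ∀ g, bar (AdjoinRoot.mk p g) = AdjoinRoot.mk p (g.comp (-X)) := fun g => by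
    rw [← AdjoinRoot.aeval_eq, ← AdjoinRoot.aeval_eq, ← aeval_algHom_apply, hbar, aeval_comp]
    simp
  refine ⟨AdjoinRoot p, i3, i4, hfin, AdjoinRoot.root p,
    LinearMap.toContinuousLinearMap (topCoeff hp), bar, topCoeff_nondegenerate hp,
    eq_top_of_root_mul_mem, hbar, fun a => ?_, fun a => ?_, hroot, fun M _ _ h hh => ?_⟩
  · obtain ⟨g, rfl⟩ := AdjoinRoot.mk_surjective a
    rw [hbar_mk, hbar_mk, comp_neg_X_comp_neg_X]
  -- The sign comes from the top degree `2j - 1`, which is odd because `j ≠ 0`.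
  · obtain ⟨g, hg, rfl⟩ := exists_mk_eq hp a
    rw [hbar_mk, LinearMap.coe_toContinuousLinearMap', topCoeff_mk hp (by rwa [degree_comp_neg_X]),
      topCoeff_mk hp hg, coeff_comp_neg_X, hdeg, Odd.neg_one_pow, neg_one_mul]
    exact ⟨j - 1, by omega⟩
  · have hh' : aeval h p = 0 := by
      simp only [p, map_pow, map_sub, aeval_X, aeval_C, Algebra.algebraMap_eq_smul_one]
      exact hh
    let ρ : AdjoinRoot p →ₐ[ℂ] Module.End ℂ M :=
      Ideal.Quotient.liftₐ (Ideal.span {p}) (aeval h) (fun g hg => by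
        obtain ⟨q, rfl⟩ := Ideal.mem_span_singleton.1 hg
        rw [map_mul, hh', zero_mul])
    refine ⟨ρ, ?_⟩
    exact (Ideal.Quotient.liftₐ_apply _ _ _ _).trans
      ((Ideal.Quotient.lift_mk _ _ _).trans (aeval_X h))

end PolynomialQuotient

/-! ### Parity of the kernel of the characteristic matrix -/

namespace DelaySystem

variable {n K : ℕ} {S : DelaySystem n K}

section Kernel

variable {A : Type*} [NormedCommRing A] [NormedAlgebra ℂ A]

/-- The kernel of the characteristic matrix as a complex vector space. -/
def kerCharMat (S : DelaySystem n K) (x : A) : Submodule ℂ (Fin n ⊕ Fin n → A) :=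
  LinearMap.ker ((S.charMat x).mulVecLin.restrictScalars ℂ)

theorem mem_kerCharMat {x : A} {a : Fin n ⊕ Fin n → A} :
    a ∈ kerCharMat S x ↔ S.charMat x *ᵥ a = 0 := Iff.rfl

theorem smul_mem_kerCharMat {x : A} (b : A) {a : Fin n ⊕ Fin n → A} (ha : a ∈ kerCharMat S x) :
    b • a ∈ kerCharMat S x := by
  rw [mem_kerCharMat] at ha ⊢
  rw [Matrix.mulVec_smul, ha, smul_zero]

variable [FiniteDimensional ℂ A]

theorem map_expAt (bar : A →ₐ[ℂ] A) (x : A) (θ : ℝ) : bar (expAt x θ) = expAt (bar x) θ := by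
  let : NormedAlgebra ℚ A := NormedAlgebra.restrictScalars ℚ ℂ A
  have : CompleteSpace A := FiniteDimensional.complete ℂ A
  rw [expAt, expAt, NormedSpace.map_exp bar (LinearMap.continuous_of_finiteDimensional
    bar.toLinearMap), map_smul]

theorem map_charMat (bar : A →ₐ[ℂ] A) (x : A) :
    (S.charMat x).map bar = S.charMat (bar x) := by
  have hr : ∀ r : ℝ, bar (ofRealAlg A r) = ofRealAlg A r := fun r => bar.commutes (r : ℂ)
  ext i j
  have h1 : bar ((1 : Matrix (Fin n ⊕ Fin n) (Fin n ⊕ Fin n) A) i j) =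
      (1 : Matrix (Fin n ⊕ Fin n) (Fin n ⊕ Fin n) A) i j := by
    rw [Matrix.one_apply]
    split <;> simp
  simp only [charMat, Matrix.map_apply, Matrix.sub_apply, Matrix.sum_apply, Matrix.add_apply,
    Matrix.smul_apply, smul_eq_mul, map_sub, map_sum, map_add, map_mul, hr, map_expAt,
    h1]

/-- With `Q = J M(x)`, the Hamiltonian symmetry and `bar x = -x` give `bar Q = Qᵀ`. Together with `t
∘ bar = -t` this makes `B(u, v) = t(∑ᵢ bar(uᵢ) (Q v)ᵢ)` skew. Its kernel is that of `M(x)`, inside a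
space of dimension `2n · dim A`. -/
theorem even_finrank_kerCharMat (x : A) (t : A →L[ℂ] ℂ) (bar : A →ₐ[ℂ] A)
    (ht : ∀ a, (∀ b, t (b * a) = 0) → a = 0) (hx : bar x = -x) (hbb : ∀ a, bar (bar a) = a)
    (htb : ∀ a, t (bar a) = -t a) : Even (Module.finrank ℂ (kerCharMat S x)) := by
  let Q := JA A n * S.charMat x
  have hQ : ∀ i k, bar (Q i k) = Q k i := by
    have h1 : Q.map bar = Qᵀ := by
      rw [transpose_JA_mul_charMat, Matrix.map_mul, map_charMat, hx]
      congr 1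
      ext i k
      exact bar.commutes ((J n i k : ℝ) : ℂ)
    exact fun i k => congrFun (congrFun h1 i) k
  let B : (Fin n ⊕ Fin n → A) →ₗ[ℂ] (Fin n ⊕ Fin n → A) →ₗ[ℂ] ℂ :=
    LinearMap.mk₂ ℂ (fun u v => t (∑ i, bar (u i) * (Q *ᵥ v) i))
      (fun u u' v => by simp [add_mul, Finset.sum_add_distrib])
      (fun c u v => by simp [← Finset.smul_sum]; ring)
      (fun u v v' => by simp [Matrix.mulVec_add, mul_add, Finset.sum_add_distrib])
      (fun c u v => by simp [Matrix.mulVec_smul, ← Finset.smul_sum]; ring)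
  have hBdef : ∀ u v, B u v = t (∑ i, bar (u i) * (Q *ᵥ v) i) := fun u v => rfl
  have hB : ∀ u v, B u v = -B v u := fun u v => by
    rw [hBdef, hBdef, ← htb]
    congr 1
    simp only [Matrix.mulVec, dotProduct, Finset.mul_sum, map_sum, map_mul, hbb, hQ]
    rw [Finset.sum_comm]
    exact Finset.sum_congr rfl fun i _ => Finset.sum_congr rfl fun k _ => by ring
  have hker : LinearMap.ker B = kerCharMat S x := by
    ext v
    rw [LinearMap.mem_ker, mem_kerCharMat]
    have h1 : S.charMat x *ᵥ v = 0 ↔ Q *ᵥ v = 0 := by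
      rw [← Matrix.mulVec_mulVec, JA_mulVec_eq_zero_iff]
    rw [h1]
    constructor
    · intro h
      funext i
      refine ht _ fun b => ?_
      -- The entry `bar b` is chosen so that the form returns `t(b (Q v)ᵢ)`.
      have h2 : B (Pi.single i (bar b)) v = 0 := by rw [hB, h]; simp
      rw [hBdef, Finset.sum_eq_single i] at h2
      · simpa [hbb] using h2
      · intro k _ hk
        simp [hk]
      · simp
    · intro h
      refine LinearMap.ext fun u => ?_
      rw [hB, hBdef, h]
      simp
  rw [← hker]
  refine even_finrank_ker_of_skew B hB ?_
  rw [Module.finrank_pi_fintype, Finset.sum_const, Finset.card_univ, Fintype.card_sum]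
  simp

end Kernel

end DelaySystem

/-! ### The action of `H = U T⁻¹` on the kernels of powers of `T - μ` -/

section Operators

variable {E : Type} [AddCommGroup E] [Module ℂ E]

/-- If `H T = U`, where `U` commutes with `T` and `U² = T + s T²`, then `H` acts on the kernels of
the powers of `T - μ`. -/
theorem exists_end_ker_pow (T U : Module.End ℂ E) (s : ℂ) (hUT : ∀ f, T (U f) = U (T f))
    (hUU : ∀ f, U (U f) = T f + s • T (T f)) {μ : ℂ} (hμ : μ ≠ 0) (j : ℕ) :
    ∃ h : Module.End ℂ (LinearMap.ker ((T - μ • (1 : Module.End ℂ E)) ^ j)),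
      (∀ φ : LinearMap.ker ((T - μ • (1 : Module.End ℂ E)) ^ j),
        ∃ f, T f = φ ∧ U f = h φ) ∧
      (h ^ 2 - (1 / μ + s) • (1 : Module.End ℂ
        (LinearMap.ker ((T - μ • (1 : Module.End ℂ E)) ^ j)))) ^ j = 0 := by
  have hcommj : Commute U ((T - μ • (1 : Module.End ℂ E)) ^ j) := by
    refine Commute.pow_right (LinearMap.ext fun f => ?_) j
    change U (T f - μ • f) = T (U f) - μ • U f
    rw [map_sub, map_smul, hUT]
  have hcommTj : Commute T ((T - μ • (1 : Module.End ℂ E)) ^ j) := by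
    refine Commute.pow_right (LinearMap.ext fun f => ?_) j
    change T (T f - μ • f) = T (T f) - μ • T f
    rw [map_sub, map_smul]
  have hmaps : ∀ V : Module.End ℂ E, Commute V ((T - μ • (1 : Module.End ℂ E)) ^ j) →
      ∀ φ ∈ LinearMap.ker ((T - μ • (1 : Module.End ℂ E)) ^ j),
        V φ ∈ LinearMap.ker ((T - μ • (1 : Module.End ℂ E)) ^ j) := fun V hV φ hφ => by
    rw [LinearMap.mem_ker] at hφ ⊢
    rw [← Module.End.mul_apply, ← hV.eq, Module.End.mul_apply, hφ, map_zero]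
  let N := LinearMap.ker ((T - μ • (1 : Module.End ℂ E)) ^ j)
  let Tn : Module.End ℂ N := T.restrict (hmaps T hcommTj)
  let Un : Module.End ℂ N := U.restrict (hmaps U hcommj)
  have hnil : (Tn - μ • (1 : Module.End ℂ N)) ^ j = 0 := by
    have h1 : ∀ k, ∀ φ : N, (((Tn - μ • (1 : Module.End ℂ N)) ^ k) φ : E) =
        ((T - μ • (1 : Module.End ℂ E)) ^ k) φ := fun k => by
      induction k with
      | zero => exact fun φ => rfl
      | succ k ih =>
        intro φ
        rw [pow_succ, pow_succ, Module.End.mul_apply, Module.End.mul_apply, ih]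
        rfl
    refine LinearMap.ext fun φ => Subtype.ext ?_
    rw [h1]
    exact φ.2
  -- On this kernel `T` is `μ ≠ 0` plus a nilpotent, hence invertible.
  have hTunit : IsUnit Tn := by
    have h1 : Tn = μ • (1 : Module.End ℂ N) + (Tn - μ • (1 : Module.End ℂ N)) := by abel
    rw [h1]
    refine IsNilpotent.isUnit_add_left_of_commute ⟨j, hnil⟩ ?_ ?_
    · rw [← Algebra.algebraMap_eq_smul_one]
      exact (isUnit_iff_ne_zero.2 hμ).map (algebraMap ℂ (Module.End ℂ N))
    · exact (Commute.one_right _).smul_right μ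
  obtain ⟨V, hV⟩ := hTunit
  have hUn : Commute Un Tn := LinearMap.ext fun φ => Subtype.ext (hUT φ).symm
  have hUnV : Commute Un ((V⁻¹ : (Module.End ℂ N)ˣ) : Module.End ℂ N) := by
    rw [← hV] at hUn
    exact hUn.units_inv_right
  have hUn2 : Un ^ 2 = Tn + s • Tn ^ 2 :=
    LinearMap.ext fun φ => Subtype.ext (hUU φ)
  let W : Module.End ℂ N := ((V⁻¹ : (Module.End ℂ N)ˣ) : Module.End ℂ N)
  have hTW : Tn * W = 1 := by rw [← hV]; exact V.mul_inv
  have hWT : W * Tn = 1 := by rw [← hV]; exact V.inv_mul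
  refine ⟨Un * W, fun φ => ?_, ?_⟩
  · have h2 : Tn (W φ) = φ := by rw [← Module.End.mul_apply, hTW, Module.End.one_apply]
    exact ⟨(W φ : N), congrArg Subtype.val h2, rfl⟩
  · have hTW2 : Tn ^ 2 * W ^ 2 = 1 := by
      rw [sq, sq, mul_assoc, ← mul_assoc Tn W W, hTW, one_mul, hTW]
    -- With `W = T⁻¹`, `(U W)² = W + s`, and `W - 1/μ = -(1/μ) W (T - μ)` is nilpotent.
    have h1 : (Un * W) ^ 2 - (1 / μ + s) • (1 : Module.End ℂ N) =
        (-(1 / μ)) • (W * (Tn - μ • (1 : Module.End ℂ N))) := by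
      rw [hUnV.mul_pow, hUn2, add_mul, smul_mul_assoc, hTW2, sq W, ← mul_assoc, hTW, one_mul,
        mul_sub, hWT, mul_smul_comm, mul_one, smul_sub, smul_smul, neg_mul,
        one_div_mul_cancel hμ]
      module
    have h2 : Commute W (Tn - μ • (1 : Module.End ℂ N)) :=
      Commute.sub_right (hWT.trans hTW.symm) ((Commute.one_right W).smul_right μ)
    rw [h1, smul_pow, h2.mul_pow, hnil, mul_zero, smul_zero]

/-- Vectors in the kernels of the powers of `T - μ` generate modules over an algebra `A` that is
generated by an element `x` with `(x² - (1/μ + s))ʲ = 0`. -/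
theorem exists_linearMap_of_mem_ker_pow {A : Type*} [CommRing A] [Algebra ℂ A] (x : A)
    (T U : Module.End ℂ E) (s : ℂ) (hUT : ∀ f, T (U f) = U (T f))
    (hUU : ∀ f, U (U f) = T f + s • T (T f)) {μ : ℂ} (hμ : μ ≠ 0) (j : ℕ)
    (hlift : ∀ (M : Type) [AddCommGroup M] [Module ℂ M] (h : Module.End ℂ M),
      (h ^ 2 - (1 / μ + s) • (1 : Module.End ℂ M)) ^ j = 0 → ∃ ρ : A →ₐ[ℂ] Module.End ℂ M, ρ x = h)
    (φ : E) (hφ : φ ∈ LinearMap.ker ((T - μ • (1 : Module.End ℂ E)) ^ j)) :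
    ∃ g : A →ₗ[ℂ] E, g 1 = φ ∧ ∀ a, ∃ f, T f = g a ∧ U f = g (x * a) := by
  obtain ⟨h, hh, hh0⟩ := exists_end_ker_pow T U s hUT hUU hμ j
  obtain ⟨ρ, hρ⟩ := hlift _ h hh0
  refine ⟨Submodule.subtype _ ∘ₗ (LinearMap.applyₗ (R := ℂ) (⟨φ, hφ⟩ : LinearMap.ker
    ((T - μ • (1 : Module.End ℂ E)) ^ j))) ∘ₗ ρ.toLinearMap, ?_, fun a => ?_⟩
  · change ((ρ 1 ⟨φ, hφ⟩ : LinearMap.ker _) : E) = _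
    rw [map_one]
    rfl
  · obtain ⟨f, h1, h2⟩ := hh (ρ a ⟨φ, hφ⟩)
    refine ⟨f, h1, h2.trans ?_⟩
    change _ = ((ρ (x * a) ⟨φ, hφ⟩ : LinearMap.ker _) : E)
    rw [map_mul, hρ]
    rfl

end Operators

/-! ### Kernels of powers of `𝓡_σ⁻¹ - μ` as kernels of the characteristic matrix -/

namespace DelaySystem

variable {n K : ℕ} {S : DelaySystem n K}

section Transfer

variable {A : Type*} [NormedCommRing A] [NormedAlgebra ℂ A]

/-- The map `a ↦ t(e^{θx} a)` as a linear map. -/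
def expFunLin (S : DelaySystem n K) [CompleteSpace A] (t : A →L[ℂ] ℂ) (x : A) :
    (Fin n ⊕ Fin n → A) →ₗ[ℂ] S.X where
  toFun := S.expFun t x
  map_add' a b := by ext θ i; simp [expFun_apply, mul_add]
  map_smul' c a := by ext θ i; simp [expFun_apply]

theorem expFunLin_apply [CompleteSpace A] (t : A →L[ℂ] ℂ) (x : A) (a : Fin n ⊕ Fin n → A) :
    expFunLin S t x a = S.expFun t x a := rfl

/-- A nondegenerate linear form represents all linear forms. -/
theorem exists_eq_mul_of_nondegenerate [FiniteDimensional ℂ A] (t : A →L[ℂ] ℂ)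
    (ht : ∀ a, (∀ b, t (b * a) = 0) → a = 0) (l : A →ₗ[ℂ] ℂ) : ∃ b, ∀ a, l a = t (a * b) := by
  let Ψ : A →ₗ[ℂ] Module.Dual ℂ A :=
    LinearMap.mk₂ ℂ (fun b a => t (a * b)) (fun b b' a => by rw [mul_add, map_add])
      (fun c b a => by rw [mul_smul_comm, map_smul]) (fun b a a' => by rw [add_mul, map_add])
      (fun c b a => by rw [smul_mul_assoc, map_smul])
  have hinj : Function.Injective Ψ := (injective_iff_map_eq_zero _).2 fun b hb =>
    ht b fun a => LinearMap.congr_fun hb a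
  obtain ⟨b, hb⟩ := (LinearMap.injective_iff_surjective_of_finrank_eq_finrank
    (Subspace.dual_finrank_eq (K := ℂ) (V := A)).symm).1 hinj l
  exact ⟨b, fun a => (LinearMap.congr_fun hb a).symm⟩

variable {σ μ : ℂ} (hσ : ¬ IsEigenvalue S.opH σ)

include hσ

theorem opRinv_expFun [CompleteSpace A] (t : A →L[ℂ] ℂ) (x : A) {a : Fin n ⊕ Fin n → A}
    (ha : a ∈ kerCharMat S x) :
    S.opRinv σ (S.expFun t x ((x ^ 2 - algebraMap ℂ A (σ ^ 2)) • a)) = S.expFun t x a := by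
  have h : ∀ b ∈ kerCharMat S x, HasH (S.expFun t x b) (S.expFun t x (x • b)) := fun b hb => by
    rw [hasH_expFun_iff, mem_kerCharMat.1 hb]
    simp
  refine opRinv_eq hσ (h a ha) (h _ (smul_mem_kerCharMat x ha)) ?_
  rw [← expFunLin_apply, ← expFunLin_apply, ← expFunLin_apply, ← map_smul, ← map_sub,
    ← mul_smul, sub_smul, ← sq, algebraMap_smul]

/-- With `u = x² - (1/μ + σ²)` nilpotent, `x² - σ² = u + 1/μ` is a unit, so `a = (u + 1/μ) b`. Then
`𝓡_σ⁻¹` takes the function of `a` to that of `b`, and `𝓡_σ⁻¹ - μ` takes it to that of `-μ u b`: each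
application produces one factor `u`. -/
theorem expFun_mem_ker_pow [CompleteSpace A] (hμ : μ ≠ 0) (t : A →L[ℂ] ℂ) (x : A)
    (hu : IsNilpotent (x ^ 2 - algebraMap ℂ A (1 / μ + σ ^ 2))) (k : ℕ) :
    ∀ a ∈ kerCharMat S x, (x ^ 2 - algebraMap ℂ A (1 / μ + σ ^ 2)) ^ k • a = 0 →
      S.expFun t x a ∈ LinearMap.ker ((S.opRinv σ - μ • (1 : Module.End ℂ S.X)) ^ k) := by
  set u := x ^ 2 - algebraMap ℂ A (1 / μ + σ ^ 2) with hu_def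
  have hw : x ^ 2 - algebraMap ℂ A (σ ^ 2) = u + algebraMap ℂ A (1 / μ) := by
    rw [hu_def, map_add]; ring
  have hunit : IsUnit (x ^ 2 - algebraMap ℂ A (σ ^ 2)) := by
    rw [hw, add_comm]
    exact hu.isUnit_add_left_of_commute
      ((isUnit_iff_ne_zero.2 (one_div_ne_zero hμ)).map (algebraMap ℂ A)) (Commute.all _ _)
  obtain ⟨w, hw'⟩ := hunit
  induction k with
  | zero =>
    intro a _ h
    rw [pow_zero, one_smul] at h
    rw [h, ← expFunLin_apply, map_zero]
    exact Submodule.zero_mem _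
  | succ k ih =>
    intro a ha h
    obtain ⟨b, hb, hab, hub⟩ : ∃ b ∈ kerCharMat S x,
        a = (x ^ 2 - algebraMap ℂ A (σ ^ 2)) • b ∧ u ^ (k + 1) • b = 0 := by
      refine ⟨((w⁻¹ : Aˣ) : A) • a, smul_mem_kerCharMat _ ha, ?_, ?_⟩
      · rw [← hw', ← mul_smul, Units.mul_inv, one_smul]
      · rw [smul_comm, h, smul_zero]
    have h1 : (S.opRinv σ - μ • (1 : Module.End ℂ S.X)) (S.expFun t x a) =
        -μ • S.expFun t x (u • b) := by
      have h2 := opRinv_expFun hσ t x hb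
      rw [← hab] at h2
      have h3 : S.expFun t x a = S.expFun t x (u • b) + (1 / μ) • S.expFun t x b := by
        conv_lhs => rw [hab, hw, add_smul, algebraMap_smul, ← expFunLin_apply, map_add,
          LinearMap.map_smul]
        rfl
      have h4 : μ * (1 / μ) = 1 := mul_one_div_cancel hμ
      rw [LinearMap.sub_apply, h2, LinearMap.smul_apply, Module.End.one_apply, h3]
      linear_combination (norm := module) -(h4 • S.expFun t x b)
    have h3 := ih (u • b) (smul_mem_kerCharMat _ hb) (by
      rw [← mul_smul, ← pow_succ, hub])
    rw [LinearMap.mem_ker] at h3 ⊢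
    rw [pow_succ, Module.End.mul_apply, h1, map_smul, h3]
    module

/-- The kernels of the powers of `𝓡_σ⁻¹ - μ` are finite-dimensional of even dimension. -/
theorem even_finrank_ker_pow (hμ : μ ≠ 0) (j : ℕ) (hj : j ≠ 0) :
    FiniteDimensional ℂ (LinearMap.ker ((S.opRinv σ - μ • (1 : Module.End ℂ S.X)) ^ j)) ∧
      Even (Module.finrank ℂ
        (LinearMap.ker ((S.opRinv σ - μ • (1 : Module.End ℂ S.X)) ^ j))) := by
  obtain ⟨A, _, _, _, x, t, bar, ht, hgen, hx, hbb, htb, hnil, hlift⟩ :=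
    exists_even_frobenius_algebra (1 / μ + σ ^ 2) j hj
  have : CompleteSpace A := FiniteDimensional.complete ℂ A
  have heq : LinearMap.ker ((S.opRinv σ - μ • (1 : Module.End ℂ S.X)) ^ j) =
      (kerCharMat S x).map (expFunLin S t x) := by
    apply le_antisymm
    · intro φ hφ
      obtain ⟨U, hU⟩ := exists_opH_comp_opRinv hσ
      have hUT : ∀ f, S.opRinv σ (U f) = U (S.opRinv σ f) := fun f => by
        obtain ⟨h1, h2⟩ := hU f
        obtain ⟨h3, h4⟩ := hU (S.opRinv σ f)
        exact opRinv_eq hσ h4 (h1.add (h3.smul (σ ^ 2))) (by module)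
      have hUU : ∀ f, U (U f) = S.opRinv σ f + σ ^ 2 • S.opRinv σ (S.opRinv σ f) := fun f => by
        have h1 := (hU (U f)).1
        rw [hUT] at h1
        exact h1.unique (hU (S.opRinv σ f)).2
      obtain ⟨g, hg1, hg2⟩ := exists_linearMap_of_mem_ker_pow x (S.opRinv σ) U (σ ^ 2) hUT hUU hμ j
        hlift φ hφ
      have hg : ∀ a, HasH (g a) (g (x * a)) := fun a => by
        obtain ⟨f, h1, h2⟩ := hg2 a
        rw [← h1, ← h2]
        exact (hU f).1
      -- The initial values `a ↦ (g a)(0)ᵢ` are linear forms on `A`, hence of the form `a ↦ t(a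
      -- bᵢ)`; these `bᵢ` make up the vector in the kernel of `M(x)`.
      have hrep := fun i => exists_eq_mul_of_nondegenerate t ht
        { toFun := fun a => g a S.pt0 i
          map_add' := fun a b => by rw [map_add]; rfl
          map_smul' := fun c a => by rw [map_smul]; rfl }
      choose b hb using hrep
      obtain ⟨h3, h4⟩ := eq_expFun_of_hasH t ht x g hg b fun a i => hb i a
      refine ⟨b, h4, ?_⟩
      rw [expFunLin_apply, ← h3, hg1]
    · rintro _ ⟨a, ha, rfl⟩
      exact expFun_mem_ker_pow hσ hμ t x ⟨j, hnil⟩ j a ha (by rw [hnil, zero_smul])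
  have hinj : Function.Injective (expFunLin S t x) :=
    (injective_iff_map_eq_zero _).2 fun a ha => expFun_injective t ht x hgen ha
  rw [heq]
  refine ⟨inferInstance, ?_⟩
  rw [← (Submodule.equivMapOfInjective _ hinj (kerCharMat S x)).finrank_eq]
  exact even_finrank_kerCharMat x t bar ht hx hbb htb

end Transfer

end DelaySystem
end HamiltonianDelay

end

theorem mainTheorem5 {n K : ℕ} (S : HamiltonianDelay.DelaySystem n K) (σ : ℂ)
    (hσ : ¬ HamiltonianDelay.IsEigenvalue S.opH σ) :
    -- the operator `𝓡_σ` maps its domain bijectively onto `X`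
    Function.Bijective (S.opR σ).toFun ∧
    -- eigenvalues of `𝓗` and eigenvalues of `𝓡_σ⁻¹`
    (∀ l : ℂ, HamiltonianDelay.IsEigenvalue S.opH l ↔
      l ^ 2 ≠ σ ^ 2 ∧ Module.End.HasEigenvalue (S.opRinv σ) (1 / (l ^ 2 - σ ^ 2))) ∧
    (∀ μ : ℂ, Module.End.HasEigenvalue (S.opRinv σ) μ →
      μ ≠ 0 ∧ ∀ s : ℂ, s ^ 2 = 1 / μ + σ ^ 2 →
        HamiltonianDelay.IsEigenvalue S.opH s ∧ HamiltonianDelay.IsEigenvalue S.opH (-s)) ∧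
    -- the eigenspace that belongs to a pair of simple eigenvalues
    (∀ (l : ℂ) (φp φm : S.X), l ≠ 0 →
      HamiltonianDelay.IsSimpleEigenvalue S.opH l →
      HamiltonianDelay.IsSimpleEigenvalue S.opH (-l) →
      HamiltonianDelay.IsEigenvector S.opH l φp →
      HamiltonianDelay.IsEigenvector S.opH (-l) φm →
      Module.End.eigenspace (S.opRinv σ) (1 / (l ^ 2 - σ ^ 2)) = Submodule.span ℂ {φp, φm}) ∧
    -- the algebraic and the geometric multiplicities are finite and even
    (∀ μ : ℂ, Module.End.HasEigenvalue (S.opRinv σ) μ →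
      FiniteDimensional ℂ (Module.End.maxGenEigenspace (S.opRinv σ) μ) ∧
      Even (Module.finrank ℂ (Module.End.maxGenEigenspace (S.opRinv σ) μ)) ∧
      Even (Module.finrank ℂ (Module.End.eigenspace (S.opRinv σ) μ))) := by
  open HamiltonianDelay HamiltonianDelay.DelaySystem in
  refine ⟨bijective_opR hσ, fun l => isEigenvalue_iff hσ, fun μ h =>
    ⟨ne_zero_of_hasEigenvalue hσ h, fun s hs =>
      ⟨isEigenvalue_of_hasEigenvalue hσ h hs,
        isEigenvalue_neg (isEigenvalue_of_hasEigenvalue hσ h hs)⟩⟩,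
    fun l φp φm hl hlp hlm hp hm => eigenspace_eq_span hσ hl hlp hlm hp hm, fun μ h => ?_⟩
  have hμ := HamiltonianDelay.DelaySystem.ne_zero_of_hasEigenvalue hσ h
  obtain ⟨k, hk⟩ := HamiltonianDelay.exists_maxGenEigenspace_eq_of_isCompactOperator _
    (HamiltonianDelay.DelaySystem.isCompactOperator_opRinv hσ) hμ
  -- The power `k + 1` gives the algebraic multiplicity, the power `1` the geometric one.
  obtain ⟨h1, h2⟩ := HamiltonianDelay.DelaySystem.even_finrank_ker_pow hσ hμ (k + 1) k.succ_ne_zero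
  obtain ⟨-, h3⟩ := HamiltonianDelay.DelaySystem.even_finrank_ker_pow hσ hμ 1 one_ne_zero
  rw [hk]
  refine ⟨h1, h2, ?_⟩
  rw [Module.End.eigenspace_def]
  rwa [pow_one, ← Algebra.algebraMap_eq_smul_one] at h3
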